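/- Let $\mathbb K\in\{\mathbb R,\mathbb C\}$, $d\ge 0$ an integer, $T>0$, and write $L^2(\mathbb R^d)$, $\mathcal D'(\mathbb R^d)$ for the $\mathbb K$-valued square integrable functions and distributions. Let $\mathcal L$ be a closed, not necessarily bounded, operator on $L^2(\mathbb R^d)$ with dense domain $D$, which generates a $C_0$-semigroup on $L^2(\mathbb R^d)$. Let $f:[0,T]\to L^2(\mathbb R^d)$ be Lipschitz continuous, let $g\in D$, and let $q\in\mathcal D'(\mathbb R^d)$ be arbitrary. Then the problem $$\Big(\frac{\partial}{\partial t}-\mathcal L\Big)u(t,x)+q(x)\,u(t,x)=f(t,x),\quad t\in(0,T],\ x\in\mathbb R^d,\qquad u(0,x)=g(x),$$ has a very weak solution with respect to a regularization of $q$ of log-type. That is, there exist a net $(q_\varepsilon)_{\varepsilon\in(0,1]}$ of smooth functions $\mathbb R^d\to\mathbb K$ and a net $(u_\varepsilon)_{\varepsilon\in(0,1]}$ in $C([0,T];D)$ ($D$ with the graph norm) with the following properties. 1. (Regularization by mollification.) There are $\varphi\in\mathcal D(\mathbb R^d)$ with $\varphi\ge 0$ and $\int\varphi=1$, numbers $l(\varepsilon)>0$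 with $l(\varepsilon)\to0$ as $\varepsilon\to0$, and smooth cut-off functions $\chi_\varepsilon:\mathbb R^d\to[0,1]$ such that for each compact $K\subset\mathbb R^d$ one has $\chi_\varepsilon=1$ on $K$ for all sufficiently small $\varepsilon$, and $$q_\varepsilon=(\chi_\varepsilon q)*\varphi_\varepsilon,\qquad \varphi_\varepsilon(x)=l(\varepsilon)^{-d}\varphi\big(x/l(\varepsilon)\big),\qquad \varepsilon\in(0,1].$$ If $q*\eta$ is bounded on $\mathbb R^d$ for every $\eta\in\mathcal D(\mathbb R^d)$ (for instance, if $q$ has compact support or $q\in L^\infty(\mathbb R^d)$), then $\chi_\varepsilon=1$ for all $\varepsilon\in(0,1]$, so that $q_\varepsilon=q*\varphi_\varepsilon$; otherwise every $\chi_\varepsilon$ has compact support. Moreover $q_\varepsilon\to q$ in $\mathcal D'(\mathbb R^d)$, that is, $\int q_\varepsilon\psi\,dx\to\langle q,\psi\rangle$ for every $\psi\in\mathcal D(\mathbb R^d)$, as $\varepsilon\to0$. 2. (Log-type.) There is $N_q>0$ with $\|q_\varepsilon\|_{L^\infty(\mathbb R^d)}\le N_q\big(1+\log\frac1\varepsilon\big)$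 for all $\varepsilon\in(0,1]$. 3. (Regularized problems.) For every $\varepsilon\in(0,1]$, $u_\varepsilon(0)=g$, and at every $t\in(0,T]$ the function $u_\varepsilon:[0,T]\to L^2(\mathbb R^d)$ is differentiable in the norm of $L^2(\mathbb R^d)$ (from the left at $t=T$) with $$u_\varepsilon'(t)-\mathcal L u_\varepsilon(t)+q_\varepsilon u_\varepsilon(t)=f(t)\quad\text{almost everywhere in }\mathbb R^d.$$ 4. (Moderateness.) There are $N\in\mathbb N_0$ and $C>0$ with $\sup_{t\in[0,T]}\|u_\varepsilon(t)\|_{L^2(\mathbb R^d)}\le C\,\varepsilon^{-N}$ for all $\varepsilon\in(0,1]$. -/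

import Mathlib

open MeasureTheory Set Filter Topology TopologicalSpace
open scoped ContDiff Distributions

/-- The space `ℝ^d`. -/
abbrev RSpace (d : ℕ) : Type := EuclideanSpace ℝ (Fin d)

/-- `L²(ℝ^d)` with values in `𝕜 = ℝ` or `ℂ`. -/
abbrev LTwo (𝕜 : Type*) [RCLike 𝕜] (d : ℕ) : Type _ :=
  Lp 𝕜 2 (volume : Measure (RSpace d))

/-- Real test functions `𝓓(ℝ^d)`. -/
abbrev TestFun (d : ℕ) : Type := 𝓓((⊤ : Opens (RSpace d)), ℝ)

/-- Distributions `𝓓'(ℝ^d)` with values in `𝕜 = ℝ` or `ℂ`. -/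
abbrev Distr (𝕜 : Type*) [RCLike 𝕜] (d : ℕ) : Type _ := 𝓓'((⊤ : Opens (RSpace d)), 𝕜)

section Semigroups

variable {𝕜 : Type*} [RCLike 𝕜] {H : Type*} [NormedAddCommGroup H] [NormedSpace 𝕜 H]

/-- `(S t)_{t ≥ 0}` is a `C₀`-semigroup; the values of `S` at negative times are irrelevant. -/
structure IsC0Semigroup (S : ℝ → H →L[𝕜] H) : Prop where
  zero : S 0 = ContinuousLinearMap.id 𝕜 H
  add : ∀ s t : ℝ, 0 ≤ s → 0 ≤ t → S (s + t) = (S s).comp (S t)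
  strongly_continuous : ∀ x : H, Tendsto (fun t => S t x) (𝓝[>] (0 : ℝ)) (𝓝 x)

/-- `L`, with its domain, is the infinitesimal generator of `S`:
`x ∈ D(L)` and `L x = y` if and only if `(S t x - x) / t → y` as `t → 0+`. -/
def IsGeneratorOf (L : H →ₗ.[𝕜] H) (S : ℝ → H →L[𝕜] H) : Prop :=
  ∀ x y : H, (x, y) ∈ L.graph ↔
    Tendsto (fun t : ℝ => ((t⁻¹ : ℝ) : 𝕜) • (S t x - x)) (𝓝[>] (0 : ℝ)) (𝓝 y)

/-- `L` is a closed operator with dense domain which generates a `C₀`-semigroup. -/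
structure IsC0Generator (L : H →ₗ.[𝕜] H) : Prop where
  closed : L.IsClosed
  dense : Dense (L.domain : Set H)
  generates : ∃ S : ℝ → H →L[𝕜] H, IsC0Semigroup S ∧ IsGeneratorOf L S

end Semigroups

section Regularization

variable {𝕜 : Type*} [RCLike 𝕜] {d : ℕ}

/-- Mollifiers: non-negative test functions of integral one. -/
structure IsMollifier (φ : TestFun d) : Prop where
  nonneg : ∀ x, 0 ≤ φ x
  integral_eq_one : ∫ x, φ x = 1

/-- `Q = (χ q) * φ_δ`, where `φ_δ(x) = δ^{-d} φ(x / δ)`, that is,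
`Q x = ⟨q, y ↦ χ(y) φ_δ(x - y)⟩` for all `x`. For `χ = 1` this is `Q = q * φ_δ`. -/
def IsCutoffMollification (q : Distr 𝕜 d) (χ : RSpace d → ℝ) (φ : TestFun d) (δ : ℝ)
    (Q : RSpace d → 𝕜) : Prop :=
  ∀ x, ∃ η : TestFun d,
    (∀ y, η y = χ y * ((δ ^ d)⁻¹ * φ (δ⁻¹ • (x - y)))) ∧ Q x = q η

/-- For every test function `η`, the smooth function `q * η` is bounded on `ℝ^d`. -/
def HasBoundedConvolutions (q : Distr 𝕜 d) : Prop :=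
  ∀ η : TestFun d, ∃ C : ℝ, ∀ x : RSpace d, ∀ θ : TestFun d,
    (∀ y, θ y = η (x - y)) → ‖q θ‖ ≤ C

/-- A net of smooth cut-off functions with values in `[0, 1]`; on every compact set they are
equal to one for all sufficiently small `ε`. -/
structure IsCutoffNet (χ : ℝ → RSpace d → ℝ) : Prop where
  smooth : ∀ ε ∈ Ioc (0 : ℝ) 1, ContDiff ℝ ∞ (χ ε)
  mem_Icc : ∀ ε ∈ Ioc (0 : ℝ) 1, ∀ y, χ ε y ∈ Icc (0 : ℝ) 1
  eventually_one : ∀ K : Set (RSpace d), IsCompact K → ∀ᶠ ε in 𝓝[>] (0 : ℝ), ∀ y ∈ K, χ ε y = 1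

/-- `(Q ε)_{ε ∈ (0, 1]}` is obtained from `q` by mollification `Q ε = (χ_ε q) * φ_{l(ε)}` with the
mollifier `φ`, the scale `l` and the cut-offs `χ_ε`. If all convolutions of `q` with test functions
are bounded then no cut-off is allowed, and `Q ε = q * φ_{l(ε)}`; otherwise the cut-offs have
compact support. -/
structure IsMollifiedNet (q : Distr 𝕜 d) (φ : TestFun d) (l : ℝ → ℝ) (χ : ℝ → RSpace d → ℝ)
    (Q : ℝ → RSpace d → 𝕜) : Prop where
  mollifier : IsMollifier φ
  scale_pos : ∀ ε ∈ Ioc (0 : ℝ) 1, 0 < l ε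
  scale_tendsto : Tendsto l (𝓝[>] (0 : ℝ)) (𝓝 0)
  cutoff : IsCutoffNet χ
  cutoff_eq_one : HasBoundedConvolutions q → ∀ ε ∈ Ioc (0 : ℝ) 1, ∀ y, χ ε y = 1
  cutoff_compact : ¬ HasBoundedConvolutions q → ∀ ε ∈ Ioc (0 : ℝ) 1, HasCompactSupport (χ ε)
  eq_mollification : ∀ ε ∈ Ioc (0 : ℝ) 1, IsCutoffMollification q (χ ε) φ (l ε) (Q ε)

/-- Regularizing nets of `q`: nets of smooth functions obtained from `q` by mollification,
which converge to `q` in the sense of distributions. -/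
structure IsRegularizingNet (q : Distr 𝕜 d) (Q : ℝ → RSpace d → 𝕜) : Prop where
  mollified : ∃ (φ : TestFun d) (l : ℝ → ℝ) (χ : ℝ → RSpace d → ℝ), IsMollifiedNet q φ l χ Q
  smooth : ∀ ε ∈ Ioc (0 : ℝ) 1, ContDiff ℝ ∞ (Q ε)
  tendsto : ∀ ψ : TestFun d,
    Tendsto (fun ε => ∫ x, ψ x • Q ε x) (𝓝[>] (0 : ℝ)) (𝓝 (q ψ))

/-- Log-type nets. Since `log (1 / ε)` vanishes at `ε = 1`, the bound is `N (1 + log (1 / ε))`;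
on `(0, ε₀]` with `ε₀ < 1` this is the same as a bound by a multiple of `log (1 / ε)`. -/
def IsLogType (Q : ℝ → RSpace d → 𝕜) : Prop :=
  ∃ N : ℝ, 0 < N ∧ ∀ ε ∈ Ioc (0 : ℝ) 1, ∀ x, ‖Q ε x‖ ≤ N * (1 + Real.log (1 / ε))

end Regularization

section VeryWeakSolutions

variable {𝕜 : Type*} [RCLike 𝕜] {d : ℕ}

/-- `u ∈ C([0,T]; D)`, where `D = L.domain` carries the graph norm, solves
`(∂/∂t - L) u + Q u = f` on `(0, T]` and `u(0) = g`. The derivative at `t = T` is the one-sided one,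
and values of `u` outside `[0, T]` are irrelevant. -/
structure IsParabolicSolution (T : ℝ) (L : LTwo 𝕜 d →ₗ.[𝕜] LTwo 𝕜 d) (Q : RSpace d → 𝕜)
    (f : ℝ → LTwo 𝕜 d) (g : L.domain) (u : ℝ → L.domain) : Prop where
  continuousOn : ContinuousOn (fun t => (u t : LTwo 𝕜 d)) (Icc 0 T)
  continuousOn_apply : ContinuousOn (fun t => L (u t)) (Icc 0 T)
  equation : ∀ t ∈ Ioc 0 T, ∃ v : LTwo 𝕜 d,
    HasDerivWithinAt (fun s => (u s : LTwo 𝕜 d)) v (Icc 0 T) t ∧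
    (fun x => v x - L (u t) x + Q x * (u t : LTwo 𝕜 d) x) =ᵐ[volume] f t
  initial : u 0 = g

/-- `C([0,T]; B)`-moderate nets: `sup_{t ∈ [0,T]} ‖u_ε(t)‖ ≤ C ε^{-N}` for all `ε ∈ (0, 1]`. -/
def IsModerateOn {B : Type*} [NormedAddCommGroup B] (T : ℝ) (u : ℝ → ℝ → B) : Prop :=
  (∀ ε ∈ Ioc (0 : ℝ) 1, ContinuousOn (u ε) (Icc 0 T)) ∧
  ∃ (N : ℕ) (C : ℝ), 0 < C ∧
    ∀ ε ∈ Ioc (0 : ℝ) 1, ∀ t ∈ Icc 0 T, ‖u ε t‖ ≤ C * (ε ^ N)⁻¹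

/-- The net `(u ε)_{ε ∈ (0, 1]}` is a very weak solution of the problem with singular potential `q`,
with `(Q ε)_{ε ∈ (0, 1]}` as the underlying regularizing net of `q`. -/
structure IsVeryWeakSolution (T : ℝ) (L : LTwo 𝕜 d →ₗ.[𝕜] LTwo 𝕜 d) (q : Distr 𝕜 d)
    (f : ℝ → LTwo 𝕜 d) (g : L.domain) (Q : ℝ → RSpace d → 𝕜) (u : ℝ → ℝ → L.domain) : Prop where
  regularizing : IsRegularizingNet q Q
  solves : ∀ ε ∈ Ioc (0 : ℝ) 1, IsParabolicSolution T L (Q ε) f g (u ε)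
  moderate : IsModerateOn T (fun ε t => (u ε t : LTwo 𝕜 d))

end VeryWeakSolutions

/-! The proof combines a sufficiently slow regularization of `q` with a solution theory for bounded
perturbations whose growth in the norm of the perturbation is explicit.

Regularization. At a fixed scale, `(χ q) * φ_δ` is smooth. It is bounded either by the hypothesis on
`q` (no cut-off) or because the cut-off makes it compactly supported. The bounds `b n` at scale
`1/(n+1)` may grow arbitrarily fast, but `exists_slow_index` selects `n(ε) → ∞` so slowly that `b (n
ε)` grows at most logarithmically. Convergence to `q` follows because pairing with `ψ` averages the
continuous function `u ↦ q(ψ(· + u))` against `φ_δ`. Smoothness and the exchange of `q` with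
integrals rest on `exists_eq_comp_jet`: on test functions supported in a fixed compact set, `q` is a
continuous functional of finitely many derivatives, so calculus and Bochner integration in a Banach
space apply.

Evolution. Multiplication by the regularized potential is a bounded operator `B`. The equation is
solved in the form `U = g + S * F` with `F = f + L g - B U`, where formally `S(t) g = g + (S * L
g)(t)`; a contraction argument gives `U`. Grönwall's inequality bounds `U` by a multiple of
`exp((2M‖B‖ + 1)T)` and, applied to increments, shows that `U` and hence `F` are Lipschitz. A
Lipschitz curve in a Hilbert space is the primitive of an integrable function
(`LipschitzWith.exists_eq_integral`), so `S * F` is continuously differentiable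
(`strongConv_eq_integral`) and takes values in the domain of `L` (`strongConv_mem_graph`). This
gives `U' = L U - B U + f`. Since `‖B‖` is at most logarithmic in `1/ε`, the exponential bound is a
power of `1/ε`. -/

/-! ### Smooth dependence on a parameter, in spaces of continuous functions. -/

section ParametricTestFunctions

universe u

variable {X E V : Type u} [NormedAddCommGroup X] [NormedSpace ℝ X]
  [NormedAddCommGroup E] [NormedSpace ℝ E] [NormedAddCommGroup V] [NormedSpace ℝ V]

/-- The map `x ↦ Ψ(x, ·)` into the continuous functions on a compact set. -/
def slice (K : Set E) (Ψ : C(X × E, V)) (x : X) : C(K, V) :=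
  ⟨fun y => Ψ (x, y), by fun_prop⟩

theorem continuous_slice (K : Set E) (Ψ : C(X × E, V)) : Continuous (slice K Ψ) :=
  ContinuousMap.continuous_of_continuous_uncurry _ <| by
    change Continuous fun p : X × K => Ψ (p.1, (p.2 : E))
    fun_prop

/-- Continuous families of linear maps, as linear maps into continuous functions. -/
noncomputable def slicePush (K : Set E) [CompactSpace K] :
    C(K, X →L[ℝ] V) →L[ℝ] X →L[ℝ] C(K, V) :=
  LinearMap.mkContinuous₂
    (LinearMap.mk₂ ℝ (fun (f : C(K, X →L[ℝ] V)) (v : X) =>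
        (⟨fun y => f y v, by fun_prop⟩ : C(K, V)))
      (fun _ _ _ => by ext; simp) (fun _ _ _ => by ext; simp)
      (fun _ _ _ => by ext; simp) (fun _ _ _ => by ext; simp)) 1
    (fun f v => by
      rw [one_mul]
      refine (ContinuousMap.norm_le _ (by positivity)).2 fun y => ?_
      exact ((f y).le_opNorm v).trans (by gcongr; exact f.norm_coe_le_norm y))

/-- Continuity of the slices of `Ψ'` in the sup norm makes the partial derivative nearly constant
near `x`, uniformly over `K`. The mean value inequality then gives a remainder estimate uniform over
`K`. -/
theorem hasFDerivAt_slice (K : Set E) [CompactSpace K] (Ψ : C(X × E, V))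
    (Ψ' : C(X × E, X →L[ℝ] V))
    (h : ∀ x y, HasFDerivAt (fun x => Ψ (x, y)) (Ψ' (x, y)) x) (x : X) :
    HasFDerivAt (slice K Ψ) (slicePush K (slice K Ψ' x)) x := by
  rw [hasFDerivAt_iff_isLittleO_nhds_zero, Asymptotics.isLittleO_iff]
  intro c hc
  have hcont := (continuous_slice K Ψ').continuousAt (x := x)
  obtain ⟨δ, hδ, hball⟩ := Metric.continuousAt_iff.1 hcont c hc
  filter_upwards [Metric.ball_mem_nhds (0 : X) hδ] with v hv
  refine (ContinuousMap.norm_le _ (by positivity)).2 fun y => ?_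
  have hconv := Convex.norm_image_sub_le_of_norm_hasFDerivWithin_le' (𝕜 := ℝ)
    (f := fun x => Ψ (x, (y : E))) (f' := fun x => Ψ' (x, (y : E)))
    (φ := Ψ' (x, (y : E))) (C := c) (s := Metric.ball x δ) (x := x) (y := x + v)
    (fun z _ => (h z y).hasFDerivWithinAt)
    (fun z hz => by
      have h1 := (hball hz).le
      rw [dist_eq_norm] at h1
      exact ((slice K Ψ' z - slice K Ψ' x).norm_coe_le_norm y).trans h1)
    (convex_ball x δ) (Metric.mem_ball_self hδ)
    (by simpa [dist_eq_norm] using hv)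
  rw [add_sub_cancel_left] at hconv
  exact hconv

/-- The derivative of a slice is a slice with values in `X →L[ℝ] V`, so the induction must run over
all targets `V` simultaneously. -/
theorem contDiff_slice_nat (K : Set E) [CompactSpace K] (n : ℕ) :
    ∀ {V : Type u} [NormedAddCommGroup V] [NormedSpace ℝ V] (Ψ : C(X × E, V)),
      ContDiff ℝ ∞ Ψ → ContDiff ℝ n (slice K Ψ) := by
  induction n with
  | zero => exact fun Ψ _ => contDiff_zero.2 (continuous_slice K Ψ)
  | succ n ih =>
    intro V _ _ Ψ hΨ
    have hs : ContDiff ℝ ∞ fun p => (fderiv ℝ Ψ p).comp (ContinuousLinearMap.inl ℝ X E) :=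
      (hΨ.fderiv_right (m := ∞) le_rfl).clm_comp contDiff_const
    let Ψ' : C(X × E, X →L[ℝ] V) := ⟨_, hs.continuous⟩
    refine contDiff_succ_iff_hasFDerivAt.2 ⟨fun x => slicePush K (slice K Ψ' x),
      ContDiff.comp (g := slicePush (X := X) (V := V) K) (ContinuousLinearMap.contDiff _) (ih Ψ' hs), hasFDerivAt_slice K Ψ Ψ' fun x y => ?_⟩
    exact ((hΨ.differentiable (by simp)) (x, y)).hasFDerivAt.comp x
      (hasFDerivAt_prodMk_left x y)

theorem contDiff_slice (K : Set E) [CompactSpace K] (Ψ : C(X × E, V)) (hΨ : ContDiff ℝ ∞ Ψ) :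
    ContDiff ℝ ∞ (slice K Ψ) :=
  contDiff_infty.2 fun n => contDiff_slice_nat K n Ψ hΨ

/-- The `i`-th partial derivative in the second variable. -/
noncomputable def sndDeriv (Φ : X × E → V) (i : ℕ) (p : X × E) : E [×i]→L[ℝ] V :=
  (iteratedFDeriv ℝ i Φ p).compContinuousLinearMap fun _ => ContinuousLinearMap.inr ℝ X E

theorem contDiff_sndDeriv {Φ : X × E → V} (hΦ : ContDiff ℝ ∞ Φ) (i : ℕ) :
    ContDiff ℝ ∞ (sndDeriv Φ i) :=
  (ContinuousMultilinearMap.compContinuousLinearMapL (𝕜 := ℝ) (F := V)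
    (fun _ : Fin i => ContinuousLinearMap.inr ℝ X E)).contDiff.comp
      (hΦ.iteratedFDeriv_right (m := ∞) (by exact_mod_cast le_top))

/-- A section is a translate of `Φ` by `(x, 0)` composed with the linear inclusion of the second
factor; iterated derivatives are compatible with both. -/
theorem iteratedFDeriv_section {Φ : X × E → V} (hΦ : ContDiff ℝ ∞ Φ) (i : ℕ) (x : X) (y : E) :
    iteratedFDeriv ℝ i (fun y => Φ (x, y)) y = sndDeriv Φ i (x, y) := by
  have h1 : (fun y => Φ (x, y))
      = (fun p => Φ (p + (x, 0))) ∘ ContinuousLinearMap.inr ℝ X E := by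
    ext y; simp
  rw [h1, ContinuousLinearMap.iteratedFDeriv_comp_right _ (n := ∞)
    (show ContDiff ℝ ∞ fun p => Φ (p + (x, 0)) by fun_prop) _ (by exact_mod_cast le_top),
    iteratedFDeriv_comp_add_right]
  simp [sndDeriv]

end ParametricTestFunctions

/-! ### Local structure of distributions: functionals of finitely many derivatives. -/

section Jets

variable {E : Type} [NormedAddCommGroup E] [NormedSpace ℝ E]

/-- Families of continuous functions on `K` with values in the multilinear maps of degrees in `s`. -/
def JetSpace (K : Set E) (s : Finset ℕ) : Type := ∀ i : s, C(K, E [×i]→L[ℝ] ℝ)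

noncomputable instance (K : Set E) [CompactSpace K] (s : Finset ℕ) :
    NormedAddCommGroup (JetSpace K s) :=
  inferInstanceAs (NormedAddCommGroup (∀ i : s, C(K, E [×i]→L[ℝ] ℝ)))

noncomputable instance (K : Set E) [CompactSpace K] (s : Finset ℕ) :
    NormedSpace ℝ (JetSpace K s) :=
  inferInstanceAs (NormedSpace ℝ (∀ i : s, C(K, E [×i]→L[ℝ] ℝ)))

instance (K : Set E) [CompactSpace K] (s : Finset ℕ) : CompleteSpace (JetSpace K s) :=
  inferInstanceAs (CompleteSpace (∀ i : s, C(K, E [×i]→L[ℝ] ℝ)))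

/-- Evaluation of one component of a jet. -/
noncomputable def JetSpace.evalCLM {K : Set E} [CompactSpace K] {s : Finset ℕ} (i : s) (y : K) :
    JetSpace K s →L[ℝ] E [×i]→L[ℝ] ℝ :=
  (ContinuousMap.evalCLM ℝ y).comp
    (ContinuousLinearMap.proj (R := ℝ) (φ := fun i : s => C(K, E [×i]→L[ℝ] ℝ)) i)

/-- The derivatives of `f` of the orders in `s`, restricted to `K`. -/
noncomputable def jet (K : Set E) (s : Finset ℕ) (f : E → ℝ) (hf : ContDiff ℝ ∞ f) :
    JetSpace K s := fun i =>
  ⟨fun y => iteratedFDeriv ℝ i f y,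
    (hf.continuous_iteratedFDeriv (by exact_mod_cast le_top)).comp continuous_subtype_val⟩

/-- On test functions supported in a fixed compact set, a distribution is a continuous functional
of finitely many derivatives. -/
theorem exists_eq_comp_jet {𝕜 : Type*} [RCLike 𝕜] (q : 𝓓'((⊤ : Opens E), 𝕜)) (K : Compacts E) :
    ∃ (s : Finset ℕ) (ℓ : JetSpace (K : Set E) s →L[ℝ] 𝕜),
      ∀ η : 𝓓((⊤ : Opens E), ℝ), (∀ y ∉ K, η y = 0) →
        q η = ℓ (jet K s η η.contDiff) := by
  have hK : (K : Set E) ⊆ (⊤ : Opens E) := fun _ _ => trivial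
  let qK : 𝓓_{K}(E, ℝ) →L[ℝ] 𝕜 :=
    (q : 𝓓((⊤ : Opens E), ℝ) →L[ℝ] 𝕜).comp (TestFunction.ofSupportedInCLM ℝ hK)
  obtain ⟨s, C, -, hC⟩ := Seminorm.bound_of_continuous
    (ContDiffMapSupportedIn.withSeminorms ℝ E ℝ ⊤ K)
    ((normSeminorm ℝ 𝕜).comp qK.toLinearMap) (continuous_norm.comp qK.continuous)
  let J : 𝓓_{K}(E, ℝ) →ₗ[ℝ] JetSpace (K : Set E) s :=
    { toFun := fun f => jet K s f f.contDiff
      map_add' := fun f g => by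
        refine funext fun i => ContinuousMap.ext fun y => ?_
        exact congrFun (iteratedFDeriv_add (f.contDiff.of_le (by exact_mod_cast le_top))
          (g.contDiff.of_le (by exact_mod_cast le_top))) y
      map_smul' := fun c f => by
        refine funext fun i => ContinuousMap.ext fun y => ?_
        exact iteratedFDeriv_const_smul_apply
          (f.contDiff.of_le (by exact_mod_cast le_top)).contDiffAt }
  have hJ : ∀ f, ‖qK f‖ ≤ C * ‖J f‖ := fun f => by
    refine (hC f).trans ?_
    change (C : ℝ) * _ ≤ _
    gcongr
    refine Seminorm.finset_sup_apply_le (norm_nonneg _) fun i hi => ?_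
    refine (ContDiffMapSupportedIn.seminorm_top_le_iff ℝ (norm_nonneg _) i f).2 fun y hy => ?_
    exact ((J f ⟨i, hi⟩).norm_coe_le_norm ⟨y, hy⟩).trans (norm_le_pi_norm (J f) ⟨i, hi⟩)
  -- The seminorm bound makes `qK` factor through the jet map, as a bounded functional on its range.
  have hker : LinearMap.ker J ≤ LinearMap.ker qK.toLinearMap := fun f hf => by
    have := hJ f
    rw [LinearMap.mem_ker.1 hf, norm_zero, mul_zero] at this
    exact norm_le_zero_iff.1 this
  let ℓ₁ : LinearMap.range J →ₗ[ℝ] 𝕜 :=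
    ((LinearMap.ker J).liftQ qK.toLinearMap hker).comp J.quotKerEquivRange.symm.toLinearMap
  have hℓ₁ : ∀ f, ℓ₁ ⟨J f, f, rfl⟩ = qK f := fun f => by
    have : J.quotKerEquivRange.symm ⟨J f, f, rfl⟩ = Submodule.Quotient.mk f :=
      (LinearEquiv.symm_apply_eq _).2 rfl
    simp only [ℓ₁, LinearMap.comp_apply, LinearEquiv.coe_coe, this]
    rfl
  let ℓ₀ : LinearMap.range J →L[ℝ] 𝕜 := ℓ₁.mkContinuous C (by
    rintro ⟨_, f, rfl⟩
    rw [hℓ₁]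
    exact hJ f)
  -- Hahn–Banach over `ℝ`, for values in the finite-dimensional real space `𝕜`.
  obtain ⟨ℓ, hℓ⟩ := ℓ₀.exist_extension_of_finiteDimensional_range
  refine ⟨s, ℓ, fun η hη => ?_⟩
  let f : 𝓓_{K}(E, ℝ) := ⟨η, η.contDiff, fun y hy => hη y hy⟩
  exact ((DFunLike.congr_fun hℓ ⟨J f, f, rfl⟩).symm.trans (hℓ₁ f)).symm

theorem jet_section {X : Type} [NormedAddCommGroup X] [NormedSpace ℝ X] {Φ : X × E → ℝ}
    (hΦ : ContDiff ℝ ∞ Φ) (K : Set E) (s : Finset ℕ) (x : X)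
    {f : E → ℝ} (hf : ContDiff ℝ ∞ f) (hfΦ : ∀ y, f y = Φ (x, y)) :
    jet K s f hf = fun i : s => slice K ⟨sndDeriv Φ i, (contDiff_sndDeriv hΦ i).continuous⟩ x := by
  obtain rfl : f = fun y => Φ (x, y) := funext hfΦ
  refine funext fun i => ContinuousMap.ext fun y => ?_
  exact iteratedFDeriv_section hΦ i x y

end Jets

/-! ### Distributions applied to smooth families: smoothness and Fubini. -/

section PairingWithSections

variable {X E : Type} [NormedAddCommGroup X] [NormedSpace ℝ X]
  [NormedAddCommGroup E] [NormedSpace ℝ E] {𝕜 : Type*} [RCLike 𝕜]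

/-- The jets of the sections `Φ(x, ·)`. -/
noncomputable def jetSlice {Φ : X × E → ℝ} (hΦ : ContDiff ℝ ∞ Φ) (K : Set E) (s : Finset ℕ)
    (x : X) : JetSpace K s :=
  fun i => slice K ⟨sndDeriv Φ i, (contDiff_sndDeriv hΦ i).continuous⟩ x

theorem contDiff_jetSlice {Φ : X × E → ℝ} (hΦ : ContDiff ℝ ∞ Φ) (K : Set E) [CompactSpace K]
    (s : Finset ℕ) : ContDiff ℝ ∞ (jetSlice hΦ K s) :=
  (contDiff_pi (𝕜 := ℝ) (F' := fun i : s => C(K, E [×i]→L[ℝ] ℝ))).2 fun i =>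
    contDiff_slice K _ (contDiff_sndDeriv hΦ i)

/-- A distribution applied to a smooth family of test functions is smooth in the parameter. -/
theorem contDiff_apply_section (q : 𝓓'((⊤ : Opens E), 𝕜)) {Φ : X × E → ℝ}
    (hΦ : ContDiff ℝ ∞ Φ) (θ : X → 𝓓((⊤ : Opens E), ℝ)) (hθ : ∀ x y, θ x y = Φ (x, y))
    (hloc : ∀ x₀, ∃ K : Compacts E, ∀ᶠ x in 𝓝 x₀, ∀ y ∉ K, Φ (x, y) = 0) :
    ContDiff ℝ ∞ fun x => q (θ x) := by
  refine contDiff_iff_contDiffAt.2 fun x₀ => ?_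
  obtain ⟨K, hK⟩ := hloc x₀
  obtain ⟨s, ℓ, hℓ⟩ := exists_eq_comp_jet q K
  refine ((ℓ.contDiff.comp (contDiff_jetSlice hΦ K s)).contDiffAt).congr_of_eventuallyEq ?_
  filter_upwards [hK] with x hx
  rw [hℓ (θ x) fun y hy => (hθ x y).trans (hx y hy),
    jet_section hΦ K s x (θ x).contDiff (hθ x)]
  rfl

variable [MeasurableSpace X] [BorelSpace X]

/-- Integration over a compact set as a continuous linear functional. -/
noncomputable def compactIntegral (μ : Measure X) [IsFiniteMeasureOnCompacts μ] (K : Set X)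
    [CompactSpace K] : C(K, ℝ) →L[ℝ] ℝ :=
  haveI : IsFiniteMeasure (μ.comap ((↑) : K → X)) := ⟨by
    have hK := isCompact_iff_compactSpace.2 ‹CompactSpace K›
    rw [Measure.comap_apply _ Subtype.coe_injective (fun s hs =>
      (MeasurableEmbedding.subtype_coe hK.measurableSet).measurableSet_image.2 hs) _ .univ]
    simpa using hK.measure_lt_top⟩
  have hint : ∀ f : C(K, ℝ), Integrable f (μ.comap ((↑) : K → X)) := fun f =>
    f.continuous.integrable_of_hasCompactSupport (HasCompactSupport.of_compactSpace f)
  LinearMap.mkContinuous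
    { toFun := fun f => ∫ x, f x ∂(μ.comap ((↑) : K → X))
      map_add' := fun f g => integral_add (hint f) (hint g)
      map_smul' := fun c f => integral_const_mul c f }
    ((μ.comap ((↑) : K → X)).real univ) fun f => by
      rw [mul_comm]
      exact norm_integral_le_of_norm_le_const (ae_of_all _ fun x => f.norm_coe_le_norm x)

theorem compactIntegral_apply (μ : Measure X) [IsFiniteMeasureOnCompacts μ] (K : Set X)
    [CompactSpace K] (f : C(K, ℝ)) (F : X → ℝ) (hF : ∀ x : K, f x = F x)
    (h0 : ∀ x ∉ K, F x = 0) : compactIntegral μ K f = ∫ x, F x ∂μ := by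
  have hK := isCompact_iff_compactSpace.2 ‹CompactSpace K›
  change ∫ x, f x ∂(μ.comap ((↑) : K → X)) = _
  simp_rw [hF]
  rw [integral_subtype_comap hK.measurableSet F]
  exact setIntegral_eq_integral_of_forall_compl_eq_zero h0

/-- With the roles of the variables exchanged, the integral is a continuous linear functional
composed with a smooth slice map. Differentiation under the integral sign thus becomes the chain
rule. -/
theorem integral_section_eq (μ : Measure X) [IsFiniteMeasureOnCompacts μ] {Φ : X × E → ℝ}
    (hΦ : ContDiff ℝ ∞ Φ) (K' : Set X) [CompactSpace K'] (h0 : ∀ x ∉ K', ∀ y, Φ (x, y) = 0) :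
    (fun y => ∫ x, Φ (x, y) ∂μ) = compactIntegral μ K' ∘
      slice K' ⟨fun p : E × X => Φ (p.2, p.1), hΦ.continuous.comp continuous_swap⟩ := by
  funext y
  exact (compactIntegral_apply μ K' _ _ (fun _ => rfl) fun x hx => h0 x hx y).symm

theorem contDiff_slice_swap {Φ : X × E → ℝ} (hΦ : ContDiff ℝ ∞ Φ) (K' : Set X)
    [CompactSpace K'] : ContDiff ℝ ∞
      (slice K' ⟨fun p : E × X => Φ (p.2, p.1), hΦ.continuous.comp continuous_swap⟩) :=
  contDiff_slice K' _ (hΦ.comp (contDiff_snd.prodMk contDiff_fst))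

theorem contDiff_integral_section (μ : Measure X) [IsFiniteMeasureOnCompacts μ] {Φ : X × E → ℝ}
    (hΦ : ContDiff ℝ ∞ Φ) (K' : Set X) [CompactSpace K'] (h0 : ∀ x ∉ K', ∀ y, Φ (x, y) = 0) :
    ContDiff ℝ ∞ fun y => ∫ x, Φ (x, y) ∂μ := by
  rw [integral_section_eq μ hΦ K' h0]
  exact (compactIntegral μ K').contDiff.comp (contDiff_slice_swap hΦ K')

theorem iteratedFDeriv_integral_section (μ : Measure X) [IsFiniteMeasureOnCompacts μ]
    {Φ : X × E → ℝ} (hΦ : ContDiff ℝ ∞ Φ) (K' : Set X) [CompactSpace K']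
    (h0 : ∀ x ∉ K', ∀ y, Φ (x, y) = 0) (i : ℕ) (y : E) (m : Fin i → E) :
    iteratedFDeriv ℝ i (fun y => ∫ x, Φ (x, y) ∂μ) y m = ∫ x, sndDeriv Φ i (x, y) m ∂μ := by
  have hsm := contDiff_slice_swap hΦ K'
  rw [integral_section_eq μ hΦ K' h0, ContinuousLinearMap.iteratedFDeriv_comp_left _
    (hsm.contDiffAt) (by exact_mod_cast le_top)]
  refine compactIntegral_apply μ K' _ _ (fun x => ?_) fun x hx => ?_
  · have h1 := (ContinuousMap.evalCLM ℝ x : C(K', ℝ) →L[ℝ] ℝ).iteratedFDeriv_comp_left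
      (hsm.contDiffAt (x := y)) (i := i) (by exact_mod_cast le_top)
    have h2 := congrArg (fun A : E [×i]→L[ℝ] ℝ => A m) h1
    refine h2.symm.trans ?_
    rw [← iteratedFDeriv_section hΦ i (x : X) y]
    rfl
  · rw [← iteratedFDeriv_section hΦ i x y]
    have : (fun y => Φ (x, y)) = 0 := funext (h0 x hx)
    rw [this]
    simp

/-- A distribution commutes with the integration of a compactly supported smooth family of test
functions with respect to the parameter. -/
theorem apply_integral_section [SecondCountableTopology X] (μ : Measure X)
    [IsFiniteMeasureOnCompacts μ]
    (q : 𝓓'((⊤ : Opens E), 𝕜)) {Φ : X × E → ℝ} (hΦ : ContDiff ℝ ∞ Φ)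
    (θ : X → 𝓓((⊤ : Opens E), ℝ)) (hθ : ∀ x y, θ x y = Φ (x, y))
    (θ₀ : 𝓓((⊤ : Opens E), ℝ)) (hθ₀ : ∀ y, θ₀ y = ∫ x, Φ (x, y) ∂μ)
    (K' : Compacts X) (h0 : ∀ x ∉ K', ∀ y, Φ (x, y) = 0)
    (K : Compacts E) (hK : ∀ x, ∀ y ∉ K, Φ (x, y) = 0) :
    q θ₀ = ∫ x, q (θ x) ∂μ := by
  obtain ⟨s, ℓ, hℓ⟩ := exists_eq_comp_jet q K
  have h1 : ∀ x, q (θ x) = ℓ (jetSlice hΦ K s x) := fun x => by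
    rw [hℓ (θ x) fun y hy => (hθ x y).trans (hK x y hy),
      jet_section hΦ K s x (θ x).contDiff (hθ x)]
    rfl
  have hsupp : ∀ x ∉ (K' : Set X), jetSlice hΦ (K : Set E) s x = 0 := fun x hx => by
    refine funext fun i => ContinuousMap.ext fun y => ?_
    change sndDeriv Φ i (x, (y : E)) = 0
    rw [← iteratedFDeriv_section hΦ i x y, show (fun y => Φ (x, y)) = 0 from funext (h0 x hx)]
    simp
  -- The family is integrated as a Bochner integral of jets, so that `ℓ` passes inside. The jet of
  -- `θ₀` is then identified by testing at points `y` and vectors `m`.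
  have hint : Integrable (jetSlice hΦ (K : Set E) s) μ :=
    (contDiff_jetSlice hΦ K s).continuous.integrable_of_hasCompactSupport
      (HasCompactSupport.intro K'.isCompact hsupp)
  simp_rw [h1]
  rw [ℓ.integral_comp_comm hint, hℓ θ₀ fun y hy => by simp [hθ₀, hK _ y hy]]
  congr 1
  refine funext fun i => ContinuousMap.ext fun y => ?_
  change _ = JetSpace.evalCLM i y (∫ x, jetSlice hΦ (K : Set E) s x ∂μ)
  rw [← ContinuousLinearMap.integral_comp_comm _ hint]
  ext m
  have h2 := ((JetSpace.evalCLM i y).integrable_comp hint)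
  have h3 := (ContinuousMultilinearMap.apply ℝ (fun _ : Fin i => E) ℝ m).integral_comp_comm h2
  refine Eq.trans ?_ h3
  change iteratedFDeriv ℝ i θ₀ y m = _
  rw [show (θ₀ : E → ℝ) = fun y => ∫ x, Φ (x, y) ∂μ from funext hθ₀,
    iteratedFDeriv_integral_section μ hΦ K' h0 i y m]
  rfl

end PairingWithSections

/-! ### Mollification with cut-offs and the log-type regularizing net. -/

section Mollification

variable {𝕜 : Type*} [RCLike 𝕜] {d : ℕ}

/-- A smooth compactly supported function as a test function. -/
def testFunOf (f : RSpace d → ℝ) (hf : ContDiff ℝ ∞ f) (hc : HasCompactSupport f) : TestFun d :=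
  ⟨f, hf, hc, fun _ _ => trivial⟩

theorem hasCompactSupport_of_norm {f : RSpace d → ℝ} {R : ℝ} (h : ∀ x, R < ‖x‖ → f x = 0) :
    HasCompactSupport f :=
  HasCompactSupport.intro (isCompact_closedBall (0 : RSpace d) R) fun x hx =>
    h x (by simpa using hx)

theorem TestFun.exists_radius (ψ : TestFun d) : ∃ R : ℝ, 0 < R ∧ ∀ x, R < ‖x‖ → ψ x = 0 := by
  obtain ⟨R, hR⟩ := ψ.hasCompactSupport.isCompact.isBounded.subset_closedBall (0 : RSpace d)
  refine ⟨max R 1, by positivity, fun x hx => image_eq_zero_of_notMem_tsupport fun h => ?_⟩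
  have := hR h
  simp only [mem_closedBall_zero_iff] at this
  exact absurd hx (not_lt.2 (this.trans (le_max_left _ _)))

/-- There is a mollifier supported in the unit ball. -/
theorem exists_mollifier (d : ℕ) :
    ∃ φ : TestFun d, IsMollifier φ ∧ ∀ x, 1 < ‖x‖ → φ x = 0 := by
  let β : ContDiffBump (0 : RSpace d) := ⟨1 / 2, 1, by norm_num, by norm_num⟩
  refine ⟨testFunOf (β.normed volume) β.contDiff_normed β.hasCompactSupport_normed,
    ⟨fun x => β.nonneg_normed x, β.integral_normed⟩, fun x hx => ?_⟩
  change β.normed volume x = 0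
  rw [← Function.notMem_support, β.support_normed_eq]
  simpa using hx.le

/-- The rescaled function `φ_δ`. -/
noncomputable def rescale (φ : TestFun d) (δ : ℝ) (z : RSpace d) : ℝ :=
  (δ ^ d)⁻¹ * φ (δ⁻¹ • z)

theorem contDiff_rescale (φ : TestFun d) (δ : ℝ) : ContDiff ℝ ∞ (rescale φ δ) :=
  contDiff_const.mul (φ.contDiff.comp (contDiff_const_smul _))

theorem rescale_eq_zero {φ : TestFun d} (hφ : ∀ x, 1 < ‖x‖ → φ x = 0) {δ : ℝ} (hδ : 0 < δ)
    {z : RSpace d} (hz : δ < ‖z‖) : rescale φ δ z = 0 := by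
  rw [rescale, hφ, mul_zero]
  rw [norm_smul, norm_inv, Real.norm_of_nonneg hδ.le, inv_mul_eq_div, one_lt_div hδ]
  exact hz

theorem rescale_nonneg {φ : TestFun d} (hφ : IsMollifier φ) {δ : ℝ} (hδ : 0 < δ) (z : RSpace d) :
    0 ≤ rescale φ δ z :=
  mul_nonneg (by positivity) (hφ.nonneg _)

theorem integral_rescale {φ : TestFun d} (hφ : IsMollifier φ) {δ : ℝ} (hδ : 0 < δ) :
    ∫ z, rescale φ δ z = 1 := by
  have h := Measure.integral_comp_smul (volume : Measure (RSpace d)) (fun z => φ z) δ⁻¹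
  simp only [rescale, integral_const_mul, h, hφ.integral_eq_one, finrank_euclideanSpace_fin]
  rw [abs_of_nonneg (by positivity)]
  simp [hδ.ne']

/-- The test function `y ↦ χ(y) φ_δ(x - y)`. -/
noncomputable def mollKernel {χ : RSpace d → ℝ} (hχ : ContDiff ℝ ∞ χ) {φ : TestFun d}
    (hφ : ∀ x, 1 < ‖x‖ → φ x = 0) {δ : ℝ} (hδ : 0 < δ) (x : RSpace d) : TestFun d :=
  testFunOf (fun y => χ y * rescale φ δ (x - y))
    (hχ.mul ((contDiff_rescale φ δ).comp (contDiff_const.sub contDiff_id)))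
    (hasCompactSupport_of_norm (R := ‖x‖ + δ) fun y hy => by
      rw [rescale_eq_zero hφ hδ, mul_zero]
      have := norm_sub_norm_le y x
      rw [norm_sub_rev]
      linarith)

section Properties

variable (q : Distr 𝕜 d) {χ : RSpace d → ℝ} (hχ : ContDiff ℝ ∞ χ) {φ : TestFun d}
  (hφ : ∀ x, 1 < ‖x‖ → φ x = 0) {δ : ℝ} (hδ : 0 < δ)

theorem contDiff_mollification : ContDiff ℝ ∞ fun x => q (mollKernel hχ hφ hδ x) := by
  refine contDiff_apply_section q (Φ := fun p => χ p.2 * rescale φ δ (p.1 - p.2))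
    ((hχ.comp contDiff_snd).mul ((contDiff_rescale φ δ).comp (contDiff_fst.sub contDiff_snd)))
    _ (fun _ _ => rfl) fun x₀ => ⟨⟨Metric.closedBall x₀ (1 + δ), isCompact_closedBall _ _⟩, ?_⟩
  filter_upwards [Metric.ball_mem_nhds x₀ one_pos] with x hx y hy
  have hy' : 1 + δ < dist y x₀ := not_le.1 hy
  have h1 : dist x x₀ < 1 := hx
  have h2 := dist_triangle y x x₀
  change χ y * rescale φ δ (x - y) = 0
  rw [rescale_eq_zero hφ hδ, mul_zero]
  rw [← dist_eq_norm, dist_comm]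
  linarith

/-- The translateTest `ψ(· + u)`. -/
noncomputable def translateTest (ψ : TestFun d) (u : RSpace d) : TestFun d :=
  testFunOf (fun y => ψ (y + u)) (ψ.contDiff.comp (contDiff_id.add contDiff_const))
    (ψ.hasCompactSupport.comp_homeomorph (Homeomorph.addRight u))

theorem continuous_apply_translate (ψ : TestFun d) : Continuous fun u => q (translateTest ψ u) := by
  obtain ⟨R, -, hR⟩ := ψ.exists_radius
  refine (contDiff_apply_section q (Φ := fun p => ψ (p.2 + p.1))
    (ψ.contDiff.comp (contDiff_snd.add contDiff_fst)) _ (fun _ _ => rfl)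
    fun u₀ => ⟨⟨Metric.closedBall 0 (R + ‖u₀‖ + 1), isCompact_closedBall _ _⟩, ?_⟩).continuous
  filter_upwards [Metric.ball_mem_nhds u₀ one_pos] with u hu y hy
  have hy' : R + ‖u₀‖ + 1 < dist y 0 := not_le.1 hy
  rw [dist_zero_right] at hy'
  have h1 : ‖u - u₀‖ < 1 := by simpa [dist_eq_norm] using hu
  refine hR _ ?_
  have h2 := norm_sub_norm_le u u₀
  have h3 := norm_sub_norm_le y (-u)
  rw [sub_neg_eq_add, norm_neg] at h3
  linarith

/-- The pairing of a mollification with a test function, as an average of translations. -/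
theorem integral_smul_mollification (ψ : TestFun d) {R : ℝ} (hR : ∀ x, R < ‖x‖ → ψ x = 0)
    (h1 : ∀ y, ‖y‖ ≤ R + δ → χ y = 1) :
    ∫ x, ψ x • q (mollKernel hχ hφ hδ x) = ∫ u, rescale φ δ u • q (translateTest ψ u) := by
  let Φ₁ : RSpace d × RSpace d → ℝ := fun p => ψ p.1 * (χ p.2 * rescale φ δ (p.1 - p.2))
  have hΦ₁ : ContDiff ℝ ∞ Φ₁ := (ψ.contDiff.comp contDiff_fst).mul ((hχ.comp contDiff_snd).mul
    ((contDiff_rescale φ δ).comp (contDiff_fst.sub contDiff_snd)))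
  let Φ₂ : RSpace d × RSpace d → ℝ := fun p => rescale φ δ p.1 * ψ (p.2 + p.1)
  have hΦ₂ : ContDiff ℝ ∞ Φ₂ := ((contDiff_rescale φ δ).comp contDiff_fst).mul
    (ψ.contDiff.comp (contDiff_snd.add contDiff_fst))
  let K₁ : Compacts (RSpace d) := ⟨Metric.closedBall 0 R, isCompact_closedBall _ _⟩
  let K₂ : Compacts (RSpace d) := ⟨Metric.closedBall 0 (R + δ), isCompact_closedBall _ _⟩
  let K₃ : Compacts (RSpace d) := ⟨Metric.closedBall 0 δ, isCompact_closedBall _ _⟩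
  have mem : ∀ (r : ℝ) (z : RSpace d), z ∉ Metric.closedBall 0 r → r < ‖z‖ := fun r z hz => by
    simpa using hz
  have hK₁ : ∀ x ∉ K₁, ∀ y, Φ₁ (x, y) = 0 := fun x hx y => by
    simp [Φ₁, hR x (mem _ _ hx)]
  have hK₂ : ∀ x, ∀ y ∉ K₂, Φ₁ (x, y) = 0 := fun x y hy => by
    have hy := mem _ _ hy
    by_cases hx : R < ‖x‖
    · simp [Φ₁, hR x hx]
    · have : δ < ‖x - y‖ := by
        have := norm_sub_norm_le y x
        rw [norm_sub_rev] at this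
        linarith
      simp [Φ₁, rescale_eq_zero hφ hδ this]
  have hK₃ : ∀ u ∉ K₃, ∀ y, Φ₂ (u, y) = 0 := fun u hu y => by
    simp [Φ₂, rescale_eq_zero hφ hδ (mem _ _ hu)]
  have hK₄ : ∀ u, ∀ y ∉ K₂, Φ₂ (u, y) = 0 := fun u y hy => by
    have hy := mem _ _ hy
    by_cases hu : δ < ‖u‖
    · simp [Φ₂, rescale_eq_zero hφ hδ hu]
    · have : R < ‖y + u‖ := by
        have := norm_sub_norm_le y (-u)
        rw [sub_neg_eq_add, norm_neg] at this
        linarith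
      simp [Φ₂, hR _ this]
  -- Substitute `u = x - y`. The cut-off equals one on `K₂`, and off `K₂` both integrands vanish.
  have heq : ∀ y, ∫ u, Φ₂ (u, y) = ∫ x, Φ₁ (x, y) := fun y => by
    by_cases hy : y ∈ K₂
    · rw [← integral_sub_right_eq_self (fun u => Φ₂ (u, y)) y]
      refine integral_congr_ae (ae_of_all _ fun x => ?_)
      simp only [Φ₁, Φ₂]
      rw [h1 y (mem_closedBall_zero_iff.1 (show y ∈ Metric.closedBall 0 (R + δ) from hy)), add_sub_cancel]
      ring
    · simp [hK₂ _ y hy, hK₄ _ y hy]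
  let θ₀ : TestFun d := testFunOf (fun y => ∫ u, Φ₂ (u, y))
    (contDiff_integral_section volume hΦ₂ K₃ hK₃)
    (hasCompactSupport_of_norm (R := R + δ) fun y hy => by
      have : y ∉ K₂ := fun h => absurd hy (not_lt.2 (mem_closedBall_zero_iff.1 (show y ∈ Metric.closedBall 0 (R + δ) from h)))
      simp [hK₄ _ y this])
  have e1 := apply_integral_section volume q hΦ₁ (fun x => ψ x • mollKernel hχ hφ hδ x)
    (fun x y => rfl) θ₀ heq K₁ hK₁ K₂ hK₂
  have e2 := apply_integral_section volume q hΦ₂ (fun u => rescale φ δ u • translateTest ψ u)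
    (fun x y => rfl) θ₀ (fun _ => rfl) K₃ hK₃ K₂ hK₄
  simp only [map_smul] at e1 e2
  exact e1.symm.trans e2

/-- The rescaled mollifier is a probability density supported in the ball of radius `δ`, so the
average deviates from `R 0` no more than `R` does on that ball. -/
theorem norm_integral_rescale_smul_sub_le {φ : TestFun d} (hφ : ∀ x, 1 < ‖x‖ → φ x = 0)
    {δ : ℝ} (hδ : 0 < δ) (hφ' : IsMollifier φ) {R : RSpace d → 𝕜}
    (hR : Continuous R) {c : ℝ} (hc : ∀ u, ‖u‖ ≤ δ → ‖R u - R 0‖ ≤ c) :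
    ‖(∫ u, rescale φ δ u • R u) - R 0‖ ≤ c := by
  have hcs : HasCompactSupport (rescale φ δ) :=
    hasCompactSupport_of_norm fun _ h => rescale_eq_zero hφ hδ h
  have hcont := (contDiff_rescale φ δ).continuous
  have hint : Integrable (rescale φ δ) := hcont.integrable_of_hasCompactSupport hcs
  have h0 : R 0 = ∫ u, rescale φ δ u • R 0 := by
    rw [integral_smul_const, integral_rescale hφ' hδ, one_smul]
  have hint2 : Integrable fun u => rescale φ δ u • R u :=
    (hcont.smul hR).integrable_of_hasCompactSupport hcs.smul_right
  calc ‖(∫ u, rescale φ δ u • R u) - R 0‖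
      = ‖∫ u, rescale φ δ u • (R u - R 0)‖ := by
        conv_lhs => rw [h0]
        rw [← integral_sub hint2 (hint.smul_const _)]
        simp_rw [smul_sub]
    _ ≤ ∫ u, rescale φ δ u * c := by
        refine norm_integral_le_of_norm_le (hint.mul_const c) (ae_of_all _ fun u => ?_)
        rw [norm_smul, Real.norm_of_nonneg (rescale_nonneg hφ' hδ u)]
        by_cases hu : ‖u‖ ≤ δ
        · exact mul_le_mul_of_nonneg_left (hc u hu) (rescale_nonneg hφ' hδ u)
        · rw [rescale_eq_zero hφ hδ (not_le.1 hu), zero_mul, zero_mul]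
    _ = c := by rw [integral_mul_const, integral_rescale hφ' hδ, one_mul]

end Properties

theorem tendsto_integral_mollification (q : Distr 𝕜 d) {χ : ℕ → RSpace d → ℝ}
    (hχ : ∀ n, ContDiff ℝ ∞ (χ n)) (hχ1 : ∀ (n : ℕ) y, ‖y‖ ≤ n → χ n y = 1)
    {φ : TestFun d} (hφ' : IsMollifier φ) (hφ : ∀ x, 1 < ‖x‖ → φ x = 0)
    {δ : ℕ → ℝ} (hδ : ∀ n, 0 < δ n) (hδ0 : Tendsto δ atTop (𝓝 0)) (ψ : TestFun d) :
    Tendsto (fun n => ∫ x, ψ x • q (mollKernel (hχ n) hφ (hδ n) x)) atTop (𝓝 (q ψ)) := by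
  obtain ⟨R, -, hR⟩ := ψ.exists_radius
  have hcont := continuous_apply_translate q ψ
  have h0 : translateTest ψ 0 = ψ := by
    ext y
    change ψ (y + 0) = ψ y
    rw [add_zero]
  rw [Metric.tendsto_atTop']
  intro ε hε
  obtain ⟨r, hr, hball⟩ := Metric.continuous_iff.1 hcont 0 (ε / 2) (by positivity)
  -- For `n ≥ N` and `δ n < 1` one has `R + δ n ≤ n`, so the cut-off is one wherever it enters the
  -- pairing.
  obtain ⟨N, hN⟩ := exists_nat_ge (R + 1)
  obtain ⟨n₀, hn₀⟩ := (eventually_atTop.1 ((hδ0.eventually (gt_mem_nhds hr)).and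
    ((hδ0.eventually (gt_mem_nhds one_pos)).and (eventually_ge_atTop N))))
  refine ⟨n₀, fun n hn => ?_⟩
  obtain ⟨hn1, hn2, hn3⟩ := hn₀ n hn.le
  have hn3' : (N : ℝ) ≤ n := by exact_mod_cast hn3
  rw [integral_smul_mollification q (hχ n) hφ (hδ n) ψ hR
    fun y hy => hχ1 n y (by linarith), dist_eq_norm]
  have := norm_integral_rescale_smul_sub_le hφ (hδ n) hφ' hcont (c := ε / 2) fun u hu => by
    have := (hball u (by simpa using hu.trans_lt hn1)).le
    rwa [dist_eq_norm] at this
  rw [h0] at this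
  linarith

/-- Any sequence of constants is dominated by a slowly growing choice of indices. -/
theorem exists_slow_index (b : ℕ → ℝ) :
    ∃ (n : ℝ → ℕ) (N : ℝ), 0 < N ∧ Tendsto n (𝓝[>] (0 : ℝ)) atTop ∧
      ∀ ε ∈ Ioc (0 : ℝ) 1, b (n ε) ≤ N * (1 + Real.log (1 / ε)) := by
  classical
  -- This makes the index `0` admissible for every `ε` in `(0, 1]`, so the greatest admissible index
  -- below `1/ε` does satisfy the bound. It tends to infinity because each fixed index is eventually
  -- admissible.
  set N : ℝ := |b 0| + 1
  have hN : 0 < N := by positivity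
  refine ⟨fun ε => Nat.findGreatest (fun n => b n ≤ N * (1 + Real.log (1 / ε))) ⌊1 / ε⌋₊, N, hN,
    tendsto_atTop.2 fun m => ?_, fun ε hε => ?_⟩
  · have hinv : Tendsto (fun ε : ℝ => 1 / ε) (𝓝[>] 0) atTop := by
      simpa using tendsto_inv_nhdsGT_zero (𝕜 := ℝ)
    have hlog : Tendsto (fun ε : ℝ => N * (1 + Real.log (1 / ε))) (𝓝[>] 0) atTop :=
      (tendsto_atTop_add_const_left _ _ (Real.tendsto_log_atTop.comp hinv)).const_mul_atTop hN
    filter_upwards [(tendsto_nat_floor_atTop.comp hinv).eventually_ge_atTop m,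
      hlog.eventually_ge_atTop (b m)] with ε h1 h2
    exact Nat.le_findGreatest h1 h2
  · refine Nat.findGreatest_spec (P := fun n => b n ≤ N * (1 + Real.log (1 / ε))) (Nat.zero_le _) ?_
    have : 0 ≤ Real.log (1 / ε) := Real.log_nonneg (by rw [le_div_iff₀ hε.1]; simpa using hε.2)
    have h1 : b 0 ≤ N := (le_abs_self _).trans (by simp [N])
    nlinarith

theorem exists_cutoff (n : ℕ) : ∃ χ : RSpace d → ℝ, ContDiff ℝ ∞ χ ∧ (∀ y, χ y ∈ Icc (0 : ℝ) 1) ∧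
    (∀ y, ‖y‖ ≤ n → χ y = 1) ∧ ∀ y, (n : ℝ) + 2 < ‖y‖ → χ y = 0 := by
  -- The inner radius is `n + 1` because it must be positive also for `n = 0`.
  let β : ContDiffBump (0 : RSpace d) := ⟨n + 1, n + 2, by positivity, by linarith⟩
  refine ⟨β, β.contDiff, fun y => ⟨β.nonneg, β.le_one⟩, fun y hy => ?_, fun y hy => ?_⟩
  · exact β.one_of_mem_closedBall (by rw [mem_closedBall_zero_iff]; exact hy.trans (by simp [β]))
  · exact β.zero_of_le_dist (by rw [dist_zero_right]; exact hy.le)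

theorem exists_cutoff_seq (q : Distr 𝕜 d) : ∃ χ : ℕ → RSpace d → ℝ,
    (∀ n, ContDiff ℝ ∞ (χ n)) ∧ (∀ n y, χ n y ∈ Icc (0 : ℝ) 1) ∧
    (∀ (n : ℕ) y, ‖y‖ ≤ n → χ n y = 1) ∧ (HasBoundedConvolutions q → ∀ n y, χ n y = 1) ∧
    (¬ HasBoundedConvolutions q → ∀ (n : ℕ) y, (n : ℝ) + 2 < ‖y‖ → χ n y = 0) := by
  by_cases hq : HasBoundedConvolutions q
  · exact ⟨fun _ _ => 1, fun _ => contDiff_const, fun _ _ => by simp, fun _ _ _ => rfl,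
      fun _ _ _ => rfl, fun h => absurd hq h⟩
  · choose χ h1 h2 h3 h4 using exists_cutoff (d := d)
    exact ⟨χ, h1, h2, h3, fun h => absurd h hq, fun _ => h4⟩

theorem exists_bound_mollification (q : Distr 𝕜 d) {χ : RSpace d → ℝ} (hχ : ContDiff ℝ ∞ χ)
    {φ : TestFun d} (hφ : ∀ x, 1 < ‖x‖ → φ x = 0) {δ : ℝ} (hδ : 0 < δ)
    (h : (HasBoundedConvolutions q ∧ ∀ y, χ y = 1) ∨ ∃ R, ∀ y, R < ‖y‖ → χ y = 0) :
    ∃ C, ∀ x, ‖q (mollKernel hχ hφ hδ x)‖ ≤ C := by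
  rcases h with ⟨hq, h1⟩ | ⟨R, hR⟩
  · obtain ⟨C, hC⟩ := hq (testFunOf (rescale φ δ) (contDiff_rescale φ δ)
      (hasCompactSupport_of_norm fun _ h => rescale_eq_zero hφ hδ h))
    refine ⟨C, fun x => hC x _ fun y => ?_⟩
    change χ y * rescale φ δ (x - y) = rescale φ δ (x - y)
    rw [h1, one_mul]
  · refine (contDiff_mollification q hχ hφ hδ).continuous.bounded_above_of_compact_support
      (HasCompactSupport.intro (isCompact_closedBall (0 : RSpace d) (R + δ)) fun x hx => ?_)
    have hx : R + δ < ‖x‖ := by simpa using hx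
    have : mollKernel hχ hφ hδ x = 0 := by
      ext y
      change χ y * rescale φ δ (x - y) = 0
      by_cases hy : R < ‖y‖
      · rw [hR y hy, zero_mul]
      · have := norm_sub_norm_le x y
        rw [rescale_eq_zero hφ hδ (by linarith), mul_zero]
    rw [this, map_zero]

/-- Every distribution has a regularizing net of log-type. -/
theorem exists_regularizingNet_logType (q : Distr 𝕜 d) :
    ∃ Q : ℝ → RSpace d → 𝕜, IsRegularizingNet q Q ∧ IsLogType Q := by
  obtain ⟨φ, hφ', hφ⟩ := exists_mollifier d
  obtain ⟨χ, hχ, hχI, hχ1, hχb, hχc⟩ := exists_cutoff_seq q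
  let δ : ℕ → ℝ := fun n => 1 / ((n : ℝ) + 1)
  have hδ : ∀ n, 0 < δ n := fun n => by positivity
  have hδ0 : Tendsto δ atTop (𝓝 0) := tendsto_one_div_add_atTop_nhds_zero_nat
  choose b hb using fun n => exists_bound_mollification q (hχ n) hφ (hδ n) (by
    by_cases h : HasBoundedConvolutions q
    · exact .inl ⟨h, hχb h n⟩
    · exact .inr ⟨_, hχc h n⟩)
  obtain ⟨n, N, hN, hn, hbn⟩ := exists_slow_index b
  refine ⟨fun ε x => q (mollKernel (hχ (n ε)) hφ (hδ (n ε)) x), ⟨⟨φ, fun ε => δ (n ε),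
    fun ε => χ (n ε), hφ', fun ε _ => hδ _, hδ0.comp hn, ⟨fun ε _ => hχ _, fun ε _ => hχI _, ?_⟩,
    fun h ε _ => hχb h _, fun h ε _ => hasCompactSupport_of_norm (hχc h (n ε)), ?_⟩,
    fun ε _ => contDiff_mollification q _ hφ _, ?_⟩, N, hN, fun ε hε x => (hb _ x).trans (hbn ε hε)⟩
  · intro K hK
    obtain ⟨R, hR⟩ := hK.isBounded.subset_closedBall (0 : RSpace d)
    obtain ⟨m, hm⟩ := exists_nat_ge R
    filter_upwards [hn.eventually_ge_atTop m] with ε hε y hy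
    refine hχ1 _ y ((mem_closedBall_zero_iff.1 (hR hy)).trans (hm.trans (by exact_mod_cast hε)))
  · exact fun ε _ x => ⟨_, fun _ => rfl, rfl⟩
  · exact fun ψ => (tendsto_integral_mollification q hχ hχ1 hφ' hφ hδ hδ0 ψ).comp hn

end Mollification

/-! ### Volterra equations and Grönwall's inequality. -/

section Volterra

variable {𝕜 : Type*} [RCLike 𝕜] {H : Type*} [NormedAddCommGroup H] [NormedSpace 𝕜 H]

/-- Strongly continuous, uniformly bounded families of operators. -/
structure IsBoundedStrongFamily (P : ℝ → H →L[𝕜] H) (M : ℝ) : Prop where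
  continuous_apply : ∀ x, Continuous fun t => P t x
  norm_le : ∀ t, ‖P t‖ ≤ M

namespace IsBoundedStrongFamily

variable {P : ℝ → H →L[𝕜] H} {M : ℝ}

theorem nonneg (hP : IsBoundedStrongFamily P M) : 0 ≤ M := (norm_nonneg _).trans (hP.norm_le 0)

theorem norm_apply_le (hP : IsBoundedStrongFamily P M) (t : ℝ) (x : H) : ‖P t x‖ ≤ M * ‖x‖ :=
  (P t).le_of_opNorm_le (hP.norm_le t) x

/-- The uniform bound makes the operators equi-Lipschitz, which upgrades strong continuity to joint
continuity. -/
theorem continuous_uncurry (hP : IsBoundedStrongFamily P M) :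
    Continuous fun p : ℝ × H => P p.1 p.2 :=
  continuous_prod_of_continuous_lipschitzWith' _ M.toNNReal
    (fun t => ((P t).lipschitz).weaken (by
      rw [← NNReal.coe_le_coe, Real.coe_toNNReal _ hP.nonneg]
      exact hP.norm_le t))
    hP.continuous_apply

theorem continuous_comp (hP : IsBoundedStrongFamily P M) {X : Type*} [TopologicalSpace X]
    {τ : X → ℝ} {F : X → H} (hτ : Continuous τ) (hF : Continuous F) :
    Continuous fun x => P (τ x) (F x) :=
  hP.continuous_uncurry.comp (hτ.prodMk hF)

end IsBoundedStrongFamily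

variable [NormedSpace ℝ H]

/-- The convolution `∫₀ᵗ P(t - s) F(s) ds`. -/
noncomputable def strongConv (P : ℝ → H →L[𝕜] H) (F : ℝ → H) (t : ℝ) : H :=
  ∫ s in (0 : ℝ)..t, P (t - s) (F s)

theorem strongConv_eq (P : ℝ → H →L[𝕜] H) (F : ℝ → H) (t : ℝ) :
    strongConv P F t = ∫ s in (0 : ℝ)..t, P s (F (t - s)) := by
  have := intervalIntegral.integral_comp_sub_left (a := 0) (b := t)
    (fun s => P s (F (t - s))) t
  simp only [sub_sub_cancel, sub_self, sub_zero] at this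
  exact this

theorem strongConv_congr (P : ℝ → H →L[𝕜] H) {F F' : ℝ → H} {t : ℝ} (ht : 0 ≤ t)
    (h : ∀ s ∈ Icc 0 t, F s = F' s) : strongConv P F t = strongConv P F' t :=
  intervalIntegral.integral_congr fun s hs => by
    rw [uIcc_of_le ht] at hs
    simp only [h s hs]

theorem IsBoundedStrongFamily.continuous_strongConv {P : ℝ → H →L[𝕜] H} {M : ℝ}
    (hP : IsBoundedStrongFamily P M) {F : ℝ → H} (hF : Continuous F) :
    Continuous (strongConv P F) :=
  intervalIntegral.continuous_parametric_intervalIntegral_of_continuous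
    (f := fun t s => P (t - s) (F s))
    (hP.continuous_comp (continuous_fst.sub continuous_snd) (hF.comp continuous_snd)) continuous_id

theorem mul_integral_exp_le {r : ℝ} (hr : 0 < r) (t : ℝ) :
    r * ∫ s in (0 : ℝ)..t, Real.exp (r * s) ≤ Real.exp (r * t) := by
  rw [intervalIntegral.integral_comp_mul_left _ hr.ne', integral_exp, smul_eq_mul,
    mul_inv_cancel_left₀ hr.ne']
  simp

/-- A form of Grönwall's inequality. -/
theorem le_exp_of_le_integral {a : ℝ → ℝ} {τ B C : ℝ} (hτ : 0 ≤ τ)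
    (ha : ContinuousOn a (Icc 0 τ)) (hB : 0 ≤ B) (hC : 0 ≤ C)
    (h : ∀ t ∈ Icc 0 τ, a t ≤ C + B * ∫ s in (0 : ℝ)..t, a s) :
    ∀ t ∈ Icc 0 τ, a t ≤ 2 * C * Real.exp ((2 * B + 1) * t) := by
  -- With this rate `B * ∫ exp(r s)` is at most `exp(r t) / 2`. At a maximum of `a t * exp(-r t)`
  -- the integral term is therefore absorbed, which costs the factor `2`; the `+ 1` keeps `r`
  -- positive when `B = 0`.
  set r := 2 * B + 1 with hr_def
  have hr : 0 < r := by positivity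
  obtain ⟨t₀, ht₀, hmax⟩ := isCompact_Icc.exists_isMaxOn (nonempty_Icc.2 hτ)
    (f := fun t => a t * Real.exp (-(r * t))) (ha.mul (by fun_prop))
  set m := a t₀ * Real.exp (-(r * t₀)) with hm_def
  have hle : ∀ t ∈ Icc 0 τ, a t ≤ m * Real.exp (r * t) := fun t ht => by
    have h1 : a t * Real.exp (-(r * t)) ≤ m := hmax ht
    have := mul_le_mul_of_nonneg_right h1 (Real.exp_pos (r * t)).le
    rwa [mul_assoc, ← Real.exp_add, neg_add_cancel, Real.exp_zero, mul_one] at this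
  have hm : m ≤ 2 * C := by
    rcases le_or_gt m 0 with hm0 | hm0
    · linarith
    have h1 : ∫ s in (0 : ℝ)..t₀, a s ≤ m * ∫ s in (0 : ℝ)..t₀, Real.exp (r * s) := by
      rw [← intervalIntegral.integral_const_mul]
      have hsub : Icc 0 t₀ ⊆ Icc 0 τ := Icc_subset_Icc_right ht₀.2
      refine intervalIntegral.integral_mono_on ht₀.1
        ((ha.mono hsub).intervalIntegrable_of_Icc ht₀.1)
        (Continuous.intervalIntegrable (by fun_prop) _ _) fun s hs => hle s (hsub hs)
    have h2 := mul_integral_exp_le hr t₀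
    have h3 := h t₀ ht₀
    set I := ∫ s in (0 : ℝ)..t₀, Real.exp (r * s)
    have hI : 0 ≤ I := intervalIntegral.integral_nonneg ht₀.1 fun s _ => (Real.exp_pos _).le
    have h5 : B * I ≤ Real.exp (r * t₀) / 2 := by nlinarith
    have h4 : a t₀ ≤ C + m * (Real.exp (r * t₀) / 2) := by
      calc a t₀ ≤ C + B * (m * I) := h3.trans (by gcongr)
        _ = C + m * (B * I) := by ring
        _ ≤ _ := by gcongr
    have h6 : m * Real.exp (r * t₀) = a t₀ := by
      rw [hm_def, mul_assoc, ← Real.exp_add, neg_add_cancel, Real.exp_zero, mul_one]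
    have h7 : 1 ≤ Real.exp (r * t₀) := Real.one_le_exp (mul_nonneg hr.le ht₀.1)
    have h8 : m * (Real.exp (r * t₀) / 2) ≤ C := by linarith
    nlinarith
  exact fun t ht => (hle t ht).trans (by gcongr)

/-- Volterra equations with strongly continuous kernels are solvable. -/
theorem IsBoundedStrongFamily.exists_volterra [CompleteSpace H] {P : ℝ → H →L[𝕜] H} {M : ℝ}
    (hP : IsBoundedStrongFamily P M) (B : H →L[𝕜] H) {h : ℝ → H} (hh : Continuous h) {T : ℝ}
    (hT : 0 ≤ T) : ∃ u : ℝ → H, Continuous u ∧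
      ∀ t ∈ Icc 0 T, u t = h t + strongConv P (fun s => B (u s)) t := by
  set r := 2 * (M * ‖B‖) + 1 with hr_def
  have hM := hP.nonneg
  have hr : 0 < r := by positivity
  -- The unknown is written as `exp(r s) z(s)`. This exponential weight makes the Volterra map a
  -- contraction with constant `1/2` on all of `[0, T]`, whatever the size of `B`.
  let ext (z : C(Icc 0 T, H)) (s : ℝ) : H := Real.exp (r * s) • z (projIcc 0 T hT s)
  have hext : ∀ z, Continuous (ext z) := fun z =>
    (by fun_prop : Continuous fun s => Real.exp (r * s)).smul
      (z.continuous.comp continuous_projIcc)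
  let Φ (z : C(Icc 0 T, H)) : C(Icc 0 T, H) :=
    ⟨fun t => Real.exp (-(r * t)) • (h t + strongConv P (fun s => B (ext z s)) t),
      ((by fun_prop : Continuous fun s : ℝ => Real.exp (-(r * s))).smul
        (hh.add (hP.continuous_strongConv (B.continuous.comp (hext z))))).comp
          continuous_subtype_val⟩
  have hΦ : ContractingWith (1 / 2 : NNReal) Φ := by
    refine ⟨by norm_num, LipschitzWith.of_dist_le_mul fun z z' => ?_⟩
    refine (ContinuousMap.dist_le (by positivity)).2 fun t => ?_
    have hint : ∀ z, IntervalIntegrable (fun s => P ((t : ℝ) - s) (B (ext z s))) volume 0 t :=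
      fun z => (hP.continuous_comp (continuous_const.sub continuous_id)
        (B.continuous.comp (hext z))).intervalIntegrable _ _
    have h1 : ‖strongConv P (fun s => B (ext z s)) t - strongConv P (fun s => B (ext z' s)) t‖
        ≤ (M * ‖B‖ * dist z z') * ∫ s in (0 : ℝ)..t, Real.exp (r * s) := by
      rw [strongConv, strongConv, ← intervalIntegral.integral_sub (hint z) (hint z'),
        ← intervalIntegral.integral_const_mul]
      refine intervalIntegral.norm_integral_le_of_norm_le t.2.1 (ae_of_all _ fun s _ => ?_)
        (Continuous.intervalIntegrable (by fun_prop) _ _)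
      rw [← map_sub, ← map_sub, ← smul_sub]
      calc _ ≤ M * (‖B‖ * (Real.exp (r * s) * dist z z')) := by
            refine (hP.norm_apply_le _ _).trans ?_
            gcongr
            refine (B.le_opNorm _).trans ?_
            gcongr
            rw [norm_smul, Real.norm_of_nonneg (Real.exp_pos _).le, ← dist_eq_norm]
            gcongr
            exact ContinuousMap.dist_apply_le_dist _
        _ = _ := by ring
    have h2 := mul_integral_exp_le hr (t : ℝ)
    set I := ∫ s in (0 : ℝ)..t, Real.exp (r * s)
    have hI : 0 ≤ I := intervalIntegral.integral_nonneg t.2.1 fun s _ => (Real.exp_pos _).le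
    have h3 : M * ‖B‖ * I ≤ Real.exp (r * t) / 2 := by nlinarith
    rw [dist_eq_norm]
    change ‖Real.exp (-(r * t)) • (h t + strongConv P (fun s => B (ext z s)) t)
      - Real.exp (-(r * t)) • (h t + strongConv P (fun s => B (ext z' s)) t)‖ ≤ _
    rw [← smul_sub, add_sub_add_left_eq_sub, norm_smul, Real.norm_of_nonneg (Real.exp_pos _).le]
    calc _ ≤ Real.exp (-(r * t)) * ((M * ‖B‖ * dist z z') * I) := by gcongr
      _ = Real.exp (-(r * t)) * dist z z' * (M * ‖B‖ * I) := by ring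
      _ ≤ Real.exp (-(r * t)) * dist z z' * (Real.exp (r * t) / 2) := by gcongr
      _ = (Real.exp (-(r * t)) * Real.exp (r * t)) * (1 / 2 * dist z z') := by ring
      _ = _ := by rw [← Real.exp_add, neg_add_cancel, Real.exp_zero, one_mul]; simp
  set z := hΦ.fixedPoint Φ
  have hz : Φ z = z := hΦ.fixedPoint_isFixedPt
  refine ⟨ext z, hext z, fun t ht => ?_⟩
  have h1 := congrArg (fun y : C(Icc 0 T, H) => Real.exp (r * t) • y ⟨t, ht⟩) hz
  simp only [Φ, ContinuousMap.coe_mk, smul_smul, ← Real.exp_add, add_neg_cancel, Real.exp_zero,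
    one_smul] at h1
  rw [h1]
  simp only [ext, projIcc_of_mem hT ht]

end Volterra

/-! ### Differentiating the convolution with a primitive. -/

section StrongConvDeriv

variable {𝕜 : Type*} [RCLike 𝕜] {H : Type*} [NormedAddCommGroup H] [NormedSpace 𝕜 H]
  [NormedSpace ℝ H]

/-- The derivative of the convolution of `P` with the function `t ↦ F₀ + ∫₀ᵗ G`. -/
noncomputable def strongConvDeriv (P : ℝ → H →L[𝕜] H) (F₀ : H) (G : ℝ → H) (t : ℝ) : H :=
  P t F₀ + ∫ s, (Ioo 0 t).indicator (fun s => P (t - s) (G s)) s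

namespace IsBoundedStrongFamily

variable {P : ℝ → H →L[𝕜] H} {M : ℝ}

/-- Dominated convergence with majorant `M * ‖G s‖`: for fixed `s > 0` the indicator jumps only at
`t = s`, so continuity at `t₀` fails at most for the null set `s = t₀`. -/
theorem continuous_strongConvDeriv (hP : IsBoundedStrongFamily P M) (F₀ : H) {G : ℝ → H}
    (hG : Integrable G) : Continuous (strongConvDeriv P F₀ G) := by
  refine (hP.continuous_apply F₀).add (continuous_iff_continuousAt.2 fun t₀ => ?_)
  refine continuousAt_of_dominated (bound := fun s => M * ‖G s‖) (.of_forall fun t => ?_)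
    (.of_forall fun t => ae_of_all _ fun s =>
      (norm_indicator_le_norm_self _ _).trans (hP.norm_apply_le _ _)) (hG.norm.const_mul M) ?_
  · exact (hP.continuous_uncurry.comp_aestronglyMeasurable
      ((by fun_prop : Continuous fun s : ℝ => t - s).aestronglyMeasurable.prodMk
        hG.aestronglyMeasurable)).indicator measurableSet_Ioo
  · filter_upwards [Measure.ae_ne volume t₀] with s hs
    rcases le_or_gt s 0 with h0 | h0
    · refine (continuousAt_const (y := (0 : H))).congr (.of_forall fun t => ?_)
      exact (indicator_of_notMem (s := Ioo 0 t) (a := s) (fun h => absurd h.1 (not_lt.2 h0)) _).symm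
    rcases lt_or_gt_of_ne hs with h | h
    · refine ContinuousAt.congr (f := fun t => P (t - s) (G s)) ?_ ?_
      · exact (hP.continuous_comp (by fun_prop) continuous_const).continuousAt
      · filter_upwards [lt_mem_nhds h] with t ht
        exact (indicator_of_mem (s := Ioo 0 t) (a := s) ⟨h0, ht⟩ fun s => P (t - s) (G s)).symm
    · refine (continuousAt_const (y := (0 : H))).congr ?_
      filter_upwards [gt_mem_nhds h] with t ht
      exact (indicator_of_notMem (s := Ioo 0 t) (a := s) (fun h => absurd h.2 (not_lt.2 ht.le)) _).symm

theorem integrable_prod_indicator (hP : IsBoundedStrongFamily P M) {G : ℝ → H}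
    (hG : Integrable G) {A : Set (ℝ × ℝ)} (hA : MeasurableSet A) {τ : ℝ × ℝ → ℝ}
    (hτ : Continuous τ) (t : ℝ) :
    Integrable (A.indicator fun p => P (τ p) (G p.2))
      ((volume.restrict (Ioc 0 t)).prod volume) := by
  refine Integrable.mono' ((hG.norm.const_mul M).comp_snd _) ?_ (ae_of_all _ fun p => ?_)
  · exact (hP.continuous_uncurry.comp_aestronglyMeasurable
      (hτ.aestronglyMeasurable.prodMk hG.aestronglyMeasurable.comp_snd)).indicator hA
  · exact (norm_indicator_le_norm_self _ _).trans (hP.norm_apply_le _ _)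

/-- For `0 < s ≤ t` this is the shift of `r` by `s`, taking `(s, t]` to `(0, t - s]`; for other `s`
both sides vanish. -/
theorem integral_triangle_eq (G : ℝ → H) {t : ℝ} (s : ℝ) :
    ∫ r in Ioc 0 t, (Ioo 0 r).indicator (fun s => P (r - s) (G s)) s
      = ∫ r in Ioc 0 t, (Ioc 0 (t - r)).indicator (fun s => P r (G s)) s := by
  by_cases hs : 0 < s ∧ s ≤ t
  · have h1 : ∀ r, (Ioo 0 r).indicator (fun s => P (r - s) (G s)) s
        = (Ioi s).indicator (fun r => P (r - s) (G s)) r := fun r => by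
      simp only [indicator_apply, mem_Ioo, mem_Ioi, hs.1, true_and]
    have h2 : ∀ r, (Ioc 0 (t - r)).indicator (fun s => P r (G s)) s
        = (Iic (t - s)).indicator (fun r => P r (G s)) r := fun r => by
      simp only [indicator_apply, mem_Ioc, mem_Iic, hs.1, true_and, le_sub_comm]
    simp_rw [h1, h2]
    rw [setIntegral_indicator measurableSet_Ioi, setIntegral_indicator measurableSet_Iic,
      show Ioc 0 t ∩ Ioi s = Ioc s t by
        ext r; simp only [mem_inter_iff, mem_Ioc, mem_Ioi]
        exact ⟨fun h => ⟨h.2, h.1.2⟩, fun h => ⟨⟨hs.1.trans h.1, h.2⟩, h.1⟩⟩,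
      show Ioc 0 t ∩ Iic (t - s) = Ioc 0 (t - s) by
        ext r; simp only [mem_inter_iff, mem_Ioc, mem_Iic]
        exact ⟨fun h => ⟨h.1.1, h.2⟩, fun h => ⟨⟨h.1, by linarith [h.2, hs.1]⟩, h.2⟩⟩,
      ← intervalIntegral.integral_of_le hs.2,
      ← intervalIntegral.integral_of_le (sub_nonneg.2 hs.2),
      intervalIntegral.integral_comp_sub_right (fun r => P r (G s)) s, sub_self]
  · rw [setIntegral_congr_fun (g := fun _ => (0 : H)) measurableSet_Ioc fun r hr =>
        indicator_of_notMem (fun h => hs ⟨h.1, h.2.le.trans hr.2⟩) _,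
      setIntegral_congr_fun (g := fun _ => (0 : H)) measurableSet_Ioc fun r hr =>
        indicator_of_notMem (fun h => hs ⟨h.1, h.2.trans (by linarith [hr.1])⟩) _]

/-- This is the integrated form of `(P * F)' = P F₀ + P * G`. Fubini on the triangle, a shift, and
Fubini back prove it using only integrability of `G` and no differentiability of `P`. -/
theorem strongConv_eq_integral [CompleteSpace H] (hP : IsBoundedStrongFamily P M) (F₀ : H)
    {G : ℝ → H} (hG : Integrable G) {t : ℝ} (ht : 0 ≤ t) :
    strongConv P (fun s => F₀ + ∫ r in (0 : ℝ)..s, G r) t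
      = ∫ r in (0 : ℝ)..t, strongConvDeriv P F₀ G r := by
  have hprim : Continuous fun s => ∫ r in (0 : ℝ)..s, G r :=
    intervalIntegral.continuous_primitive (fun _ _ => hG.intervalIntegrable) 0
  have hF₀ : IntervalIntegrable (fun s => P s F₀) volume 0 t :=
    (hP.continuous_apply F₀).intervalIntegrable _ _
  rw [strongConv_eq]
  simp only [map_add]
  have hconv : Continuous fun s => P s (∫ r in (0 : ℝ)..t - s, G r) :=
    hP.continuous_comp continuous_id (hprim.comp (continuous_const.sub continuous_id))
  rw [intervalIntegral.integral_add hF₀ (hconv.intervalIntegrable _ _)]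
  have hw : Continuous fun r => ∫ s, (Ioo 0 r).indicator (fun s => P (r - s) (G s)) s := by
    refine ((hP.continuous_strongConvDeriv F₀ hG).sub (hP.continuous_apply F₀)).congr fun r => ?_
    simp [strongConvDeriv]
  simp only [strongConvDeriv]
  rw [intervalIntegral.integral_add hF₀ (hw.intervalIntegrable _ _)]
  congr 1
  rw [intervalIntegral.integral_of_le ht, intervalIntegral.integral_of_le ht]
  have hA : MeasurableSet {p : ℝ × ℝ | p.2 ∈ Ioo 0 p.1} :=
    (measurableSet_lt measurable_const measurable_snd).inter
      (measurableSet_lt measurable_snd measurable_fst)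
  have hA' : MeasurableSet {p : ℝ × ℝ | p.2 ∈ Ioc 0 (t - p.1)} :=
    (measurableSet_lt measurable_const measurable_snd).inter
      (measurableSet_le measurable_snd (measurable_const.sub measurable_fst))
  have e1 := integral_integral_swap
    (f := fun r s => (Ioo 0 r).indicator (fun s => P (r - s) (G s)) s)
    (hP.integrable_prod_indicator hG hA (continuous_fst.sub continuous_snd) t)
  have e2 := integral_integral_swap
    (f := fun r s => (Ioc 0 (t - r)).indicator (fun s => P r (G s)) s)
    (hP.integrable_prod_indicator hG hA' continuous_fst t)
  rw [e1]
  simp_rw [integral_triangle_eq]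
  rw [← e2]
  refine setIntegral_congr_fun measurableSet_Ioc fun r hr => ?_
  rw [integral_indicator measurableSet_Ioc, ← intervalIntegral.integral_of_le (by linarith [hr.2]),
    ContinuousLinearMap.intervalIntegral_comp_comm _ hG.intervalIntegrable]

end IsBoundedStrongFamily

end StrongConvDeriv

/-! ### C₀-semigroups and their generators. -/

section Generator

variable {𝕜 : Type*} [RCLike 𝕜] {H : Type*} [NormedAddCommGroup H] [NormedSpace 𝕜 H]
  {S : ℝ → H →L[𝕜] H}

namespace IsC0Semigroup

theorem tendsto_nhdsGE (hS : IsC0Semigroup S) (x : H) :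
    Tendsto (fun t => S t x) (𝓝[≥] (0 : ℝ)) (𝓝 x) := by
  have h : ContinuousWithinAt (fun t => S t x) (Ioi 0) 0 := by
    have := hS.strongly_continuous x
    rwa [ContinuousWithinAt, hS.zero]
  have h2 := continuousWithinAt_Ioi_iff_Ici.1 h
  rwa [ContinuousWithinAt, hS.zero] at h2

/-- Unboundedness near `0` would give times `t n → 0` with `‖S (t n)‖ > n`, against
Banach–Steinhaus, since `S (t n) x` converges for every `x`. The semigroup law propagates the bound
in steps of length `δ`. -/
theorem exists_norm_le [CompleteSpace H] (hS : IsC0Semigroup S) (τ : ℝ) :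
    ∃ M, ∀ t ∈ Icc 0 τ, ‖S t‖ ≤ M := by
  obtain ⟨δ, hδ, M, hM⟩ : ∃ δ > 0, ∃ M, ∀ t ∈ Icc 0 δ, ‖S t‖ ≤ M := by
    by_contra! hcon
    choose t ht hlt using fun n : ℕ => hcon (1 / ((n : ℝ) + 1)) (by positivity) n
    have ht0 : Tendsto t atTop (𝓝[≥] 0) := tendsto_nhdsWithin_iff.2
      ⟨squeeze_zero (fun n => (ht n).1) (fun n => (ht n).2) tendsto_one_div_add_atTop_nhds_zero_nat,
        .of_forall fun n => (ht n).1⟩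
    obtain ⟨C, hC⟩ := banach_steinhaus (g := fun n => S (t n)) fun x => by
      obtain ⟨C, hC⟩ := ((hS.tendsto_nhdsGE x).comp ht0).norm.bddAbove_range
      exact ⟨C, fun n => hC ⟨n, rfl⟩⟩
    obtain ⟨n, hn⟩ := exists_nat_gt C
    exact absurd (hC n) (not_le.2 (hn.trans (hlt n)))
  have hM0 : 0 ≤ M := (norm_nonneg _).trans (hM 0 ⟨le_rfl, hδ.le⟩)
  have key : ∀ n : ℕ, ∃ M', ∀ t ∈ Icc 0 ((n + 1 : ℝ) * δ), ‖S t‖ ≤ M' := by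
    intro n
    induction n with
    | zero => exact ⟨M, by simpa using hM⟩
    | succ n ih =>
      obtain ⟨M', hM'⟩ := ih
      refine ⟨max M' (M' * M), fun t ht => ?_⟩
      rcases le_or_gt t ((n + 1 : ℝ) * δ) with h | h
      · exact (hM' t ⟨ht.1, h⟩).trans (le_max_left _ _)
      · refine le_trans ?_ (le_max_right _ _)
        have h1 : 0 ≤ (n + 1 : ℝ) * δ := by positivity
        have h2 := ht.2
        push_cast at h2
        have hn : 0 ≤ (n : ℝ) * δ := by positivity
        have e := hS.add (t - δ) δ (by linarith) hδ.le
        rw [sub_add_cancel] at e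
        rw [e]
        refine (ContinuousLinearMap.opNorm_comp_le _ _).trans ?_
        have h3 := hM' (t - δ) ⟨by linarith, by linarith⟩
        have h4 := hM δ ⟨hδ.le, le_rfl⟩
        exact mul_le_mul h3 h4 (norm_nonneg _) ((norm_nonneg _).trans h3)
  obtain ⟨n, hn⟩ := exists_nat_ge (τ / δ)
  obtain ⟨M', hM'⟩ := key n
  refine ⟨M', fun t ht => hM' t ⟨ht.1, ht.2.trans ?_⟩⟩
  rw [div_le_iff₀ hδ] at hn
  nlinarith

/-- A `C₀`-semigroup, frozen outside a compact interval. -/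
theorem exists_boundedStrongFamily [CompleteSpace H] (hS : IsC0Semigroup S) {τ : ℝ}
    (hτ : 0 ≤ τ) : ∃ (P : ℝ → H →L[𝕜] H) (M : ℝ), IsBoundedStrongFamily P M ∧
      ∀ t ∈ Icc 0 τ, P t = S t := by
  obtain ⟨M, hM⟩ := hS.exists_norm_le τ
  -- Factoring out the semigroup at the earlier of the two times reduces two-sided continuity to
  -- right continuity at `0`.
  have hdiff : ∀ x, ∀ s ∈ Icc 0 τ, ∀ t ∈ Icc 0 τ,
      ‖S t x - S s x‖ ≤ M * ‖S |t - s| x - x‖ := by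
    intro x
    have aux : ∀ s ∈ Icc 0 τ, ∀ t ∈ Icc 0 τ, s ≤ t → ‖S t x - S s x‖ ≤ M * ‖S |t - s| x - x‖ := by
      intro s hs t ht hst
      have e := hS.add s (t - s) hs.1 (sub_nonneg.2 hst)
      rw [add_sub_cancel] at e
      rw [e, abs_of_nonneg (sub_nonneg.2 hst), ContinuousLinearMap.comp_apply, ← map_sub]
      exact (S s).le_of_opNorm_le (hM s hs) _
    intro s hs t ht
    rcases le_total s t with h | h
    · exact aux s hs t ht h
    · rw [norm_sub_rev, abs_sub_comm]
      exact aux t ht s hs h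
  refine ⟨fun t => S (projIcc 0 τ hτ t), M, ⟨fun x => ?_, fun t => hM _ (projIcc 0 τ hτ t).2⟩,
    fun t ht => by simp only [projIcc_of_mem hτ ht]⟩
  have hc : Continuous fun t : Icc 0 τ => S t x := by
    refine continuous_iff_continuousAt.2 fun t₀ => ?_
    rw [ContinuousAt, tendsto_iff_norm_sub_tendsto_zero]
    refine squeeze_zero (fun _ => norm_nonneg _) (fun t => hdiff x t₀ t₀.2 t t.2) ?_
    have h1 : Tendsto (fun t : Icc 0 τ => |(t : ℝ) - t₀|) (𝓝 t₀) (𝓝[≥] 0) := by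
      refine tendsto_nhdsWithin_iff.2 ⟨?_, .of_forall fun t => mem_Ici.2 (abs_nonneg _)⟩
      have : Continuous fun t : Icc 0 τ => |(t : ℝ) - t₀| := by fun_prop
      simpa using this.tendsto t₀
    have h2 := (((hS.tendsto_nhdsGE x).comp h1).sub_const x).norm.const_mul M
    simpa using h2
  exact hc.comp continuous_projIcc

end IsC0Semigroup

variable [NormedSpace ℝ H]

theorem IsBoundedStrongFamily.tendsto_average [CompleteSpace H] {P : ℝ → H →L[𝕜] H} {M : ℝ}
    (hP : IsBoundedStrongFamily P M) {F : ℝ → H} (hF : Continuous F) (t : ℝ) :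
    Tendsto (fun h : ℝ => h⁻¹ • ∫ s in t..t + h, P (t + h - s) (F s)) (𝓝[>] 0)
      (𝓝 (P 0 (F t))) := by
  have hc : Continuous fun p : ℝ × ℝ => P p.1 (F p.2) :=
    hP.continuous_comp continuous_fst (hF.comp continuous_snd)
  rw [Metric.tendsto_nhds]
  intro ε hε
  obtain ⟨δ, hδ, hball⟩ := Metric.continuous_iff.1 hc (0, t) (ε / 2) (by positivity)
  filter_upwards [Ioo_mem_nhdsGT hδ] with h hh
  have hint : IntervalIntegrable (fun s => P (t + h - s) (F s)) volume t (t + h) :=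
    (hP.continuous_comp (by fun_prop) hF).intervalIntegrable _ _
  have hle : ‖∫ s in t..t + h, (P (t + h - s) (F s) - P 0 (F t))‖ ≤ ε / 2 * |t + h - t| := by
    refine intervalIntegral.norm_integral_le_of_norm_le_const fun s hs => ?_
    rw [uIoc_of_le (by linarith [hh.1])] at hs
    rw [← dist_eq_norm]
    refine (hball (t + h - s, s) ?_).le
    rw [Prod.dist_eq, max_lt_iff, Real.dist_eq, Real.dist_eq]
    constructor <;> rw [abs_lt] <;> constructor <;> simp only <;> linarith [hs.1, hs.2, hh.1, hh.2]
  rw [intervalIntegral.integral_sub hint (by simp), intervalIntegral.integral_const,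
    add_sub_cancel_left, abs_of_pos hh.1] at hle
  rw [dist_eq_norm]
  have e : h⁻¹ • (∫ s in t..t + h, P (t + h - s) (F s)) - P 0 (F t)
      = h⁻¹ • ((∫ s in t..t + h, P (t + h - s) (F s)) - h • P 0 (F t)) := by
    rw [smul_sub, inv_smul_smul₀ hh.1.ne']
  rw [e, norm_smul, norm_inv, Real.norm_of_nonneg hh.1.le]
  calc _ ≤ h⁻¹ * (ε / 2 * h) := by have := hh.1; gcongr
    _ = ε / 2 := by field_simp [hh.1.ne']
    _ < ε := by linarith

/-- If the convolution of a `C₀`-semigroup with `F` is differentiable with derivative `w`, then it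
takes values in the domain of the generator `L`, and `L (S * F) = w - F`. -/
theorem IsGeneratorOf.strongConv_mem_graph [CompleteSpace H] [IsScalarTower ℝ 𝕜 H]
    {L : H →ₗ.[𝕜] H} (hL : IsGeneratorOf L S) (hS : IsC0Semigroup S) {P : ℝ → H →L[𝕜] H} {M T : ℝ}
    (hP : IsBoundedStrongFamily P M) (hPS : ∀ t ∈ Icc 0 (T + 1), P t = S t) {F w : ℝ → H}
    (hF : Continuous F) (hw : Continuous w)
    (hv : ∀ t ∈ Icc 0 (T + 1), strongConv P F t = ∫ s in (0 : ℝ)..t, w s) {t : ℝ} (ht : t ∈ Icc 0 T) :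
    (strongConv P F t, w t - F t) ∈ L.graph := by
  rw [hL]
  have h1 := (intervalIntegral.integral_hasDerivAt_right (hw.intervalIntegrable 0 t)
    hw.aestronglyMeasurable.stronglyMeasurableAtFilter hw.continuousAt).tendsto_slope_zero_right
  have hP0 : P 0 (F t) = F t := by
    rw [hPS 0 ⟨le_rfl, by linarith [ht.1, ht.2]⟩, hS.zero]; rfl
  have h2 := hP.tendsto_average hF t
  rw [hP0] at h2
  refine (h1.sub h2).congr' ?_
  filter_upwards [Ioo_mem_nhdsGT one_pos] with h hh
  have hint : ∀ a b, IntervalIntegrable (fun s => P (t + h - s) (F s)) volume a b := fun a b =>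
    (hP.continuous_comp (by fun_prop) hF).intervalIntegrable _ _
  have e1 : S h (strongConv P F t) = ∫ s in (0 : ℝ)..t, P (t + h - s) (F s) := by
    rw [strongConv, ← ContinuousLinearMap.intervalIntegral_comp_comm _
      ((hP.continuous_comp (by fun_prop) hF).intervalIntegrable _ _)]
    refine intervalIntegral.integral_congr fun s hs => ?_
    rw [uIcc_of_le ht.1] at hs
    rw [hPS (t - s) ⟨by linarith [hs.2], by linarith [hs.1, ht.2]⟩,
      hPS (t + h - s) ⟨by linarith [hs.2, hh.1], by linarith [hs.1, ht.2, hh.2]⟩,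
      show t + h - s = h + (t - s) by ring, hS.add h (t - s) hh.1.le (by linarith [hs.2])]
    rfl
  -- Thus the generator's difference quotient is that of the convolution minus an average over `[t,
  -- t + h]`, with limits `w t` and `F t`. The interval `[0, T + 1]` leaves room for `h < 1`.
  have e2 : S h (strongConv P F t) = strongConv P F (t + h)
      - ∫ s in t..t + h, P (t + h - s) (F s) := by
    rw [e1, eq_sub_iff_add_eq, strongConv,
      intervalIntegral.integral_add_adjacent_intervals (hint _ _) (hint _ _)]
  rw [e2, ← hv t ⟨ht.1, by linarith [ht.2]⟩,
    ← hv (t + h) ⟨by linarith [ht.1, hh.1], by linarith [ht.2, hh.2]⟩, ← smul_sub,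
    ← algebraMap_smul 𝕜 h⁻¹, RCLike.algebraMap_eq_ofReal]
  congr 1
  abel

end Generator

/-! ### Weak compactness and the Radon–Nikodym property of Hilbert spaces. -/

section WeakCompactness

variable {𝕜 : Type*} [RCLike 𝕜]

/-- Bounded sequences in a Hilbert space have weak limits along ultrafilters. -/
theorem exists_tendsto_inner_hyperfilter {X : Type*} [NormedAddCommGroup X] [InnerProductSpace 𝕜 X]
    [CompleteSpace X] (φ : ℕ → X) {R : ℝ} (hφ : ∀ n, ‖φ n‖ ≤ R) :
    ∃ y : X, ∀ x, Tendsto (fun n => inner 𝕜 x (φ n)) (hyperfilter ℕ) (𝓝 (inner 𝕜 x y)) := by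
  let ℓ : ℕ → WeakDual 𝕜 X := fun n => StrongDual.toWeakDual (InnerProductSpace.toDual 𝕜 X (φ n))
  obtain ⟨ξ, -, hξ⟩ := (WeakDual.isCompact_closedBall (𝕜 := 𝕜) (E := X) 0 R).ultrafilter_le_nhds
    ((hyperfilter ℕ).map ℓ) (le_principal_iff.2 (by
      refine Filter.mem_map.2 (univ_mem' fun n => ?_)
      change InnerProductSpace.toDual 𝕜 X (φ n) ∈ Metric.closedBall 0 R
      simpa using hφ n))
  refine ⟨(InnerProductSpace.toDual 𝕜 X).symm (WeakDual.toStrongDual ξ), fun x => ?_⟩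
  have h1 : Tendsto (fun n => ℓ n x) (hyperfilter ℕ) (𝓝 (ξ x)) :=
    ((WeakDual.eval_continuous x).tendsto ξ).comp hξ
  have h2 := (RCLike.continuous_conj.tendsto (ξ x)).comp h1
  -- The Riesz map puts `φ n` in the conjugate-linear slot, hence the conjugation.
  have e1 : (fun n => inner 𝕜 x (φ n)) = (starRingEnd 𝕜) ∘ fun n => ℓ n x := by
    funext n
    change inner 𝕜 x (φ n) = (starRingEnd 𝕜) (inner 𝕜 (φ n) x)
    rw [inner_conj_symm]
  have e2 : inner 𝕜 x ((InnerProductSpace.toDual 𝕜 X).symm (WeakDual.toStrongDual ξ))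
      = (starRingEnd 𝕜) (ξ x) := by
    rw [← inner_conj_symm, InnerProductSpace.toDual_symm_apply]
    rfl
  rw [e1, e2]
  exact h2

variable {H : Type*} [NormedAddCommGroup H] [InnerProductSpace 𝕜 H] [CompleteSpace H]
  [NormedSpace ℝ H]

/-- Lipschitz curves in a Hilbert space are primitives of integrable functions. -/
theorem LipschitzWith.exists_eq_integral (𝕜 : Type*) [RCLike 𝕜] [InnerProductSpace 𝕜 H]
    {F : ℝ → H} {K : NNReal} (hF : LipschitzWith K F) (T : ℝ) :
    ∃ G : ℝ → H, Integrable G ∧ ∀ t ∈ Icc 0 T, F t = F 0 + ∫ s in (0 : ℝ)..t, G s := by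
  let μ : Measure ℝ := volume.restrict (Ioc 0 T)
  let D : ℕ → ℝ → H := fun n s => ((n : ℝ) + 1) • (F (s + 1 / ((n : ℝ) + 1)) - F s)
  have hDc : ∀ n, Continuous (D n) := fun n =>
    ((hF.continuous.comp (by fun_prop)).sub hF.continuous).const_smul _
  have hDb : ∀ n s, ‖D n s‖ ≤ K := fun n s => by
    have h1 := hF.norm_sub_le (s + 1 / ((n : ℝ) + 1)) s
    have hn : 0 < (n : ℝ) + 1 := by positivity
    rw [add_sub_cancel_left, Real.norm_of_nonneg (by positivity)] at h1
    rw [norm_smul, Real.norm_of_nonneg hn.le]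
    calc _ ≤ ((n : ℝ) + 1) * (K * (1 / ((n : ℝ) + 1))) := by gcongr
      _ = K := by field_simp
  have hDm : ∀ n, MemLp (D n) 2 μ := fun n =>
    MemLp.of_bound (hDc n).aestronglyMeasurable K (ae_of_all _ (hDb n))
  -- The difference quotients are bounded in `L²(0, T; H)`; their weak limit is the candidate
  -- derivative. Testing it against `x` times the indicator of `(0, t]` yields the increment `F t -
  -- F 0`.
  obtain ⟨y, hy⟩ := exists_tendsto_inner_hyperfilter (𝕜 := 𝕜) (X := Lp H 2 μ)
    (fun n => (hDm n).toLp (D n)) (R := (measureUnivNNReal μ : ℝ) ^ ((2 : ENNReal).toReal)⁻¹ * K)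
    fun n => Lp.norm_le_of_ae_bound K.2 (by
      filter_upwards [(hDm n).coeFn_toLp] with s hs
      rw [hs]
      exact hDb n s)
  have hyint : Integrable y μ := (Lp.memLp y).integrable (by norm_num)
  refine ⟨(Ioc 0 T).indicator y, (integrable_indicator_iff measurableSet_Ioc).2 hyint,
    fun t ht => ?_⟩
  have hsub : Ioc 0 t ⊆ Ioc 0 T := Ioc_subset_Ioc_right ht.2
  have hrestr : μ.restrict (Ioc 0 t) = volume.restrict (Ioc 0 t) :=
    Measure.restrict_restrict_of_subset hsub
  have hG : ∫ s in (0 : ℝ)..t, (Ioc 0 T).indicator y s = ∫ s in Ioc 0 t, y s ∂μ := by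
    rw [intervalIntegral.integral_of_le ht.1, hrestr]
    exact setIntegral_congr_fun measurableSet_Ioc fun s hs => indicator_of_mem (hsub hs) _
  have hlim : Tendsto (fun n => ∫ s in (0 : ℝ)..t, D n s) atTop (𝓝 (F t - F 0)) := by
    have hder : ∀ a : ℝ, Tendsto (fun n : ℕ => ((n : ℝ) + 1) •
        ((∫ s in (0 : ℝ)..a + 1 / ((n : ℝ) + 1), F s) - ∫ s in (0 : ℝ)..a, F s))
        atTop (𝓝 (F a)) := fun a => by
      have h1 := (intervalIntegral.integral_hasDerivAt_right
        (hF.continuous.intervalIntegrable 0 a)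
        hF.continuous.aestronglyMeasurable.stronglyMeasurableAtFilter
        hF.continuous.continuousAt).tendsto_slope_zero_right
      have h2 : Tendsto (fun n : ℕ => 1 / ((n : ℝ) + 1)) atTop (𝓝[>] 0) :=
        tendsto_nhdsWithin_iff.2 ⟨tendsto_one_div_add_atTop_nhds_zero_nat,
          .of_forall fun n => mem_Ioi.2 (by positivity)⟩
      refine (h1.comp h2).congr fun n => ?_
      simp
    refine ((hder t).sub (hder 0)).congr fun n => ?_
    have hFi : ∀ a b, IntervalIntegrable F volume a b :=
      fun a b => hF.continuous.intervalIntegrable _ _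
    have hFs : Continuous fun s => F (s + 1 / ((n : ℝ) + 1)) := hF.continuous.comp (by fun_prop)
    simp only [D]
    rw [intervalIntegral.integral_smul, intervalIntegral.integral_sub
      (hFs.intervalIntegrable _ _) (hFi _ _), intervalIntegral.integral_comp_add_right, ← smul_sub, intervalIntegral.integral_same,
      sub_zero, zero_add]
    congr 1
    rw [← intervalIntegral.integral_add_adjacent_intervals (hFi 0 (1 / ((n : ℝ) + 1)))
      (hFi (1 / ((n : ℝ) + 1)) (t + 1 / ((n : ℝ) + 1)))]
    abel
  have hfin : μ (Ioc 0 t) ≠ ⊤ := measure_ne_top _ _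
  have hinner : ∀ x : H, inner 𝕜 x (∫ s in Ioc 0 t, y s ∂μ) = inner 𝕜 x (F t - F 0) := fun x => by
    have h1 := hy (indicatorConstLp 2 measurableSet_Ioc hfin x)
    simp only [L2.inner_indicatorConstLp_eq_inner_setIntegral] at h1
    refine tendsto_nhds_unique h1 ?_
    have h2 := (((innerSL 𝕜 x).continuous.tendsto _).comp hlim).mono_left Nat.hyperfilter_le_atTop
    refine h2.congr fun n => ?_
    simp only [Function.comp_apply, innerSL_apply_apply]
    rw [intervalIntegral.integral_of_le ht.1, ← hrestr]
    congr 1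
    refine integral_congr_ae (ae_restrict_of_ae ?_)
    exact (hDm n).coeFn_toLp.symm
  rw [hG, ext_inner_left 𝕜 hinner, add_sub_cancel]

end WeakCompactness

/-! ### The Cauchy problem with a bounded perturbation. -/

section CauchyProblem

variable {𝕜 : Type*} [RCLike 𝕜] {H : Type*} [NormedAddCommGroup H]

section Estimates

variable [NormedSpace 𝕜 H] [NormedSpace ℝ H] {P : ℝ → H →L[𝕜] H} {M : ℝ}

theorem IsBoundedStrongFamily.norm_strongConv_le (hP : IsBoundedStrongFamily P M) {F : ℝ → H}
    (hF : Continuous F) {t : ℝ} (ht : 0 ≤ t) :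
    ‖strongConv P F t‖ ≤ ∫ s in (0 : ℝ)..t, M * ‖F s‖ :=
  intervalIntegral.norm_integral_le_of_norm_le ht (ae_of_all _ fun _ _ => hP.norm_apply_le _ _)
    ((hF.norm.const_mul M).intervalIntegrable _ _)

theorem IsBoundedStrongFamily.norm_le_exp (hP : IsBoundedStrongFamily P M) {F U : ℝ → H}
    (hF : Continuous F) (hU : Continuous U) {g : H} {T b C : ℝ} (hT : 0 ≤ T) (hb : 0 ≤ b)
    (hC : 0 ≤ C) (hFU : ∀ s ∈ Icc 0 T, ‖F s‖ ≤ C + b * ‖U s‖)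
    (hUF : ∀ t ∈ Icc 0 T, U t = g + strongConv P F t) :
    ∀ t ∈ Icc 0 T, ‖U t‖ ≤ 2 * (‖g‖ + M * C * T) * Real.exp ((2 * (M * b) + 1) * t) := by
  have hM := hP.nonneg
  refine le_exp_of_le_integral hT hU.norm.continuousOn (by positivity) (by positivity) ?_
  intro t ht
  have h1 : ∫ s in (0 : ℝ)..t, M * ‖F s‖ ≤ ∫ s in (0 : ℝ)..t, (M * C + M * b * ‖U s‖) := by
    refine intervalIntegral.integral_mono_on ht.1 ((hF.norm.const_mul M).intervalIntegrable _ _)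
      ((by fun_prop : Continuous fun s => M * C + M * b * ‖U s‖).intervalIntegrable _ _)
      fun s hs => ?_
    calc M * ‖F s‖ ≤ M * (C + b * ‖U s‖) := by
          gcongr
          exact hFU s ⟨hs.1, hs.2.trans ht.2⟩
      _ = _ := by ring
  rw [intervalIntegral.integral_add (by simp)
    ((by fun_prop : Continuous fun s => M * b * ‖U s‖).intervalIntegrable _ _),
    intervalIntegral.integral_const, intervalIntegral.integral_const_mul (M * b), sub_zero,
    smul_eq_mul] at h1
  have h2 : t * (M * C) ≤ T * (M * C) := by have := ht.2; gcongr
  have h3 := hP.norm_strongConv_le hF ht.1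
  rw [hUF t ht]
  have h4 := norm_add_le g (strongConv P F t)
  linarith

/-- The increment of `U` over `h` is an integral over an interval of length `h`, plus a convolution
with the increment of `F`. The first is `O(h)`, and Grönwall absorbs the second. -/
theorem IsBoundedStrongFamily.lipschitzOnWith (hP : IsBoundedStrongFamily P M) {F U : ℝ → H}
    (hF : Continuous F) (hU : Continuous U) {g : H} {T K b : ℝ} (hT : 0 ≤ T) (hK : 0 ≤ K)
    (hb : 0 ≤ b) (hFU : ∀ s h, 0 ≤ h → ‖F (s + h) - F s‖ ≤ K * h + b * ‖U (s + h) - U s‖)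
    (hUF : ∀ t ∈ Icc 0 T, U t = g + strongConv P F t) :
    ∃ K', LipschitzOnWith K' U (Icc 0 T) := by
  have hM := hP.nonneg
  obtain ⟨C, hC⟩ := (isCompact_Icc (a := 0) (b := T)).exists_bound_of_continuousOn hF.continuousOn
  have hC0 : 0 ≤ C := (norm_nonneg _).trans (hC 0 ⟨le_rfl, hT⟩)
  set K' := 2 * (M * C + M * K * T) * Real.exp ((2 * (M * b) + 1) * T) with hK'
  have key : ∀ s ∈ Icc 0 T, ∀ t ∈ Icc 0 T, s ≤ t → ‖U t - U s‖ ≤ K' * (t - s) := by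
    intro s hs t ht hst
    set h := t - s with hh
    have hh0 : 0 ≤ h := sub_nonneg.2 hst
    have hmain : ∀ r ∈ Icc 0 (T - h), ‖U (r + h) - U r‖ ≤ (M * C + M * K * T) * h
        + M * b * ∫ σ in (0 : ℝ)..r, ‖U (σ + h) - U σ‖ := by
      intro r hr
      have hcF : ∀ c : ℝ, Continuous fun σ => P σ (F (c - σ)) := fun c =>
        hP.continuous_comp continuous_id (hF.comp (by fun_prop))
      have e1 : U (r + h) - U r = (∫ σ in r..r + h, P σ (F (r + h - σ)))
          + ∫ σ in (0 : ℝ)..r, P σ (F (r + h - σ) - F (r - σ)) := by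
        simp only [map_sub]
        rw [hUF (r + h) ⟨by linarith [hr.1], by linarith [hr.2]⟩,
          hUF r ⟨hr.1, by linarith [hr.2]⟩, add_sub_add_left_eq_sub, strongConv_eq, strongConv_eq,
          intervalIntegral.integral_sub ((hcF _).intervalIntegrable _ _)
            ((hcF _).intervalIntegrable _ _),
          ← intervalIntegral.integral_add_adjacent_intervals
            ((hcF (r + h)).intervalIntegrable 0 r) ((hcF (r + h)).intervalIntegrable r (r + h))]
        abel
      have e2 : ‖∫ σ in r..r + h, P σ (F (r + h - σ))‖ ≤ M * C * |r + h - r| := by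
        refine intervalIntegral.norm_integral_le_of_norm_le_const fun σ hσ => ?_
        rw [uIoc_of_le (by linarith)] at hσ
        refine (hP.norm_apply_le _ _).trans ?_
        gcongr
        exact hC _ ⟨by linarith [hσ.2], by linarith [hσ.1, hr.1, hr.2]⟩
      rw [add_sub_cancel_left, abs_of_nonneg hh0] at e2
      have hcU : Continuous fun σ => ‖U (σ + h) - U σ‖ := by fun_prop
      have e3 : ‖∫ σ in (0 : ℝ)..r, P σ (F (r + h - σ) - F (r - σ))‖
          ≤ ∫ σ in (0 : ℝ)..r, (M * K * h + M * b * ‖U (r - σ + h) - U (r - σ)‖) := by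
        refine intervalIntegral.norm_integral_le_of_norm_le hr.1 (ae_of_all _ fun σ _ => ?_)
          ((continuous_const.add ((hcU.comp (by fun_prop : Continuous fun σ => r - σ)).const_mul
            (M * b))).intervalIntegrable _ _)
        have := hFU (r - σ) h hh0
        rw [show r + h - σ = r - σ + h by ring]
        calc _ ≤ M * (K * h + b * ‖U (r - σ + h) - U (r - σ)‖) :=
              (hP.norm_apply_le _ _).trans (by gcongr)
          _ = _ := by ring
      rw [intervalIntegral.integral_comp_sub_left
        (fun σ => M * K * h + M * b * ‖U (σ + h) - U σ‖) r, sub_self, sub_zero,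
        intervalIntegral.integral_add (by simp) ((hcU.const_mul _).intervalIntegrable _ _),
        intervalIntegral.integral_const, intervalIntegral.integral_const_mul, sub_zero,
        smul_eq_mul] at e3
      have e4 : r * (M * K * h) ≤ T * (M * K * h) := by
        have : r ≤ T := by linarith [hr.2]
        gcongr
      rw [e1]
      refine (norm_add_le _ _).trans ?_
      linarith
    have h1 := le_exp_of_le_integral (τ := T - h) (by linarith [hs.1, ht.2])
      (by fun_prop : Continuous fun σ => ‖U (σ + h) - U σ‖).continuousOn
      (by positivity) (by positivity) hmain s ⟨hs.1, by linarith [ht.2]⟩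
    rw [show s + h = t by ring] at h1
    refine h1.trans ?_
    have h2 : Real.exp ((2 * (M * b) + 1) * s) ≤ Real.exp ((2 * (M * b) + 1) * T) := by
      have := hs.2
      gcongr
    calc _ ≤ 2 * ((M * C + M * K * T) * h) * Real.exp ((2 * (M * b) + 1) * T) := by gcongr
      _ = K' * h := by rw [hK']; ring
  have hK'0 : 0 ≤ K' := by positivity
  refine ⟨K'.toNNReal, LipschitzOnWith.of_dist_le_mul fun s hs t ht => ?_⟩
  rw [Real.coe_toNNReal _ hK'0, dist_eq_norm, Real.dist_eq]
  rcases le_total s t with h | h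
  · rw [norm_sub_rev, abs_sub_comm, abs_of_nonneg (sub_nonneg.2 h)]
    exact key s hs t ht h
  · rw [abs_of_nonneg (sub_nonneg.2 h)]
    exact key t ht s hs h

end Estimates

variable [InnerProductSpace 𝕜 H] [NormedSpace ℝ H] [IsScalarTower ℝ 𝕜 H] [CompleteSpace H]

/-- The Cauchy problem `u' = L u - B u + f`, `u(0) = g` for a generator `L`, a bounded operator `B`,
Lipschitz data `f` and `g ∈ D(L)`, with a bound that is explicit in `‖B‖`. -/
theorem IsC0Generator.exists_solution {L : H →ₗ.[𝕜] H} (hL : IsC0Generator L) {T : ℝ} (hT : 0 ≤ T)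
    {f : ℝ → H} {K : NNReal} (hf : LipschitzOnWith K f (Icc 0 T)) (g : L.domain) :
    ∃ M C : ℝ, 0 ≤ M ∧ 0 ≤ C ∧ ∀ B : H →L[𝕜] H, ∃ u : ℝ → L.domain,
      ContinuousOn (fun t => (u t : H)) (Icc 0 T) ∧ ContinuousOn (fun t => L (u t)) (Icc 0 T) ∧
      u 0 = g ∧
      ∀ t ∈ Icc 0 T,
        HasDerivWithinAt (fun s => (u s : H)) (L (u t) - B (u t) + f t) (Icc 0 T) t ∧
        ‖(u t : H)‖ ≤ C * Real.exp ((2 * (M * ‖B‖) + 1) * T) := by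
  obtain ⟨S, hS, hLS⟩ := hL.generates
  obtain ⟨P, M, hP, hPS⟩ := hS.exists_boundedStrongFamily (τ := T + 1) (by linarith)
  have hM := hP.nonneg
  -- Moving `L g` into the source leaves the constant `g` as initial term in place of `S(t) g`; this
  -- is where `g ∈ D(L)` enters.
  let c : ℝ → H := fun t => f (projIcc 0 T hT t) + L g
  have hcL : LipschitzWith K c := LipschitzWith.of_dist_le_mul fun s t => by
    rw [dist_add_right]
    refine (hf.dist_le_mul _ (projIcc 0 T hT s).2 _ (projIcc 0 T hT t).2).trans ?_
    gcongr
    have := (LipschitzWith.projIcc hT).dist_le_mul s t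
    rwa [NNReal.coe_one, one_mul, Subtype.dist_eq] at this
  obtain ⟨C, hC⟩ := (isCompact_Icc (a := 0) (b := T)).exists_bound_of_continuousOn
    hcL.continuous.continuousOn
  have hC0 : 0 ≤ C := (norm_nonneg _).trans (hC 0 ⟨le_rfl, hT⟩)
  -- The constants are fixed before `B`, so they are uniform over the regularized problems.
  refine ⟨M, 2 * (‖(g : H)‖ + M * C * T), hM, by positivity, fun B => ?_⟩
  obtain ⟨U, hU, hUeq⟩ := hP.exists_volterra (-B)
    (continuous_const.add (hP.continuous_strongConv hcL.continuous) :
      Continuous fun t => (g : H) + strongConv P c t) hT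
  let F : ℝ → H := fun s => c s - B (U s)
  have hF : Continuous F := hcL.continuous.sub (B.continuous.comp hU)
  have hUF : ∀ t ∈ Icc 0 T, U t = g + strongConv P F t := fun t ht => by
    have h1 : IntervalIntegrable (fun s => P (t - s) (c s)) volume 0 t :=
      (hP.continuous_comp (by fun_prop) hcL.continuous).intervalIntegrable _ _
    have h2 : IntervalIntegrable (fun s => P (t - s) (B (U s))) volume 0 t :=
      (hP.continuous_comp (by fun_prop) (B.continuous.comp hU)).intervalIntegrable _ _
    rw [hUeq t ht]
    change (g : H) + strongConv P c t + _ = _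
    rw [add_assoc]
    simp only [strongConv, F, neg_apply, map_neg, map_sub]
    rw [intervalIntegral.integral_neg, intervalIntegral.integral_sub h1 h2, sub_eq_add_neg]
  obtain ⟨K', hK'⟩ := hP.lipschitzOnWith hF hU hT K.2 (norm_nonneg B) (fun s h hh => by
    have h1 := hcL.norm_sub_le (s + h) s
    rw [add_sub_cancel_left, Real.norm_of_nonneg hh] at h1
    have h2 : F (s + h) - F s = (c (s + h) - c s) - B (U (s + h) - U s) := by
      simp only [F, map_sub]; abel
    rw [h2]
    exact (norm_sub_le _ _).trans (add_le_add h1 (B.le_opNorm _))) hUF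
  have hbound := hP.norm_le_exp hF hU hT (norm_nonneg B) hC0
    (fun s hs => (norm_sub_le _ _).trans (add_le_add (hC s hs) (B.le_opNorm _))) hUF
  -- `U` is known to be Lipschitz only on `[0, T]`; freezing `F` outside gives a globally Lipschitz
  -- source, usable up to `T + 1`.
  let F' : ℝ → H := fun t => F (projIcc 0 T hT t)
  have hFF' : ∀ t ∈ Icc 0 T, F' t = F t := fun t ht => by simp only [F', projIcc_of_mem hT ht]
  have hF' : LipschitzWith (K + ‖B‖₊ * K') F' := LipschitzWith.of_dist_le_mul fun s t => by
    have h0 : dist (projIcc 0 T hT s : ℝ) (projIcc 0 T hT t) ≤ dist s t := by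
      have := (LipschitzWith.projIcc hT).dist_le_mul s t
      rwa [NNReal.coe_one, one_mul, Subtype.dist_eq] at this
    have h1 := hcL.dist_le_mul (projIcc 0 T hT s) (projIcc 0 T hT t)
    have h2 := B.lipschitz.dist_le_mul (U (projIcc 0 T hT s)) (U (projIcc 0 T hT t))
    have h3 := hK'.dist_le_mul _ (projIcc 0 T hT s).2 _ (projIcc 0 T hT t).2
    refine (dist_sub_sub_le _ _ _ _).trans ((add_le_add h1 h2).trans ?_)
    push_cast
    calc _ ≤ K * dist s t + ‖B‖ * (K' * dist s t) :=
          add_le_add (mul_le_mul_of_nonneg_left h0 K.2) (mul_le_mul_of_nonneg_left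
            (h3.trans (mul_le_mul_of_nonneg_left h0 K'.2)) (norm_nonneg B))
      _ = _ := by ring
  obtain ⟨G, hG, hGF⟩ := hF'.exists_eq_integral 𝕜 (T + 1)
  set w := strongConvDeriv P (F' 0) G with hw_def
  have hw : Continuous w := hP.continuous_strongConvDeriv _ hG
  have hv : ∀ t ∈ Icc 0 (T + 1), strongConv P F' t = ∫ s in (0 : ℝ)..t, w s := fun t ht => by
    rw [strongConv_congr P ht.1 fun s hs => hGF s ⟨hs.1, hs.2.trans ht.2⟩,
      hP.strongConv_eq_integral _ hG ht.1]
  have hUw : ∀ t ∈ Icc 0 T, U t = g + ∫ s in (0 : ℝ)..t, w s := fun t ht => by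
    rw [hUF t ht, ← hv t ⟨ht.1, by linarith [ht.2]⟩,
      strongConv_congr P ht.1 fun s hs => (hFF' s ⟨hs.1, hs.2.trans ht.2⟩)]
  have hgraph : ∀ t ∈ Icc 0 T, (U t, w t - f t + B (U t)) ∈ L.graph := fun t ht => by
    have h1 := hLS.strongConv_mem_graph hS hP hPS hF'.continuous hw hv ht
    have h2 := L.graph.add_mem (L.mem_graph g) h1
    rw [Prod.mk_add_mk, hv t ⟨ht.1, by linarith [ht.2]⟩, ← hUw t ht, hFF' t ht] at h2
    convert h2 using 2
    simp only [F, c, projIcc_of_mem hT ht]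
    abel
  choose u hu hLu using fun t : Icc 0 T => (L.mem_graph_iff).1 (hgraph t t.2)
  have huU : ∀ t ∈ Icc 0 T, (u (projIcc 0 T hT t) : H) = U t := fun t ht => by
    rw [projIcc_of_mem hT ht, hu]
  have hLU : ∀ t ∈ Icc 0 T, L (u (projIcc 0 T hT t)) = w t - f t + B (U t) := fun t ht => by
    rw [projIcc_of_mem hT ht, hLu]
  refine ⟨fun t => u (projIcc 0 T hT t), hU.continuousOn.congr huU, ?_, ?_, fun t ht => ⟨?_, ?_⟩⟩
  · exact ((hw.continuousOn.sub hf.continuousOn).add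
      (B.continuous.comp hU).continuousOn).congr hLU
  · have h0 : (0 : ℝ) ∈ Icc 0 T := ⟨le_rfl, hT⟩
    refine Subtype.ext ?_
    rw [huU 0 h0, hUw 0 h0]
    simp
  · have h1 : HasDerivAt (fun t => (g : H) + ∫ s in (0 : ℝ)..t, w s) (w t) t :=
      (intervalIntegral.integral_hasDerivAt_right (hw.intervalIntegrable 0 t)
        hw.aestronglyMeasurable.stronglyMeasurableAtFilter hw.continuousAt).const_add _
    rw [hLU t ht, huU t ht, show w t - f t + B (U t) - B (U t) + f t = w t by abel]
    exact h1.hasDerivWithinAt.congr (fun s hs => (huU s hs).trans (hUw s hs))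
      ((huU t ht).trans (hUw t ht))
  · rw [huU t ht]
    refine (hbound t ht).trans ?_
    have := ht.2
    gcongr

end CauchyProblem

/-! ### Multiplication operators and moderateness. -/

section Multiplication

variable {𝕜 : Type*} [RCLike 𝕜] {d : ℕ}

/-- Multiplication by a bounded continuous function is a bounded operator on `L²`. -/
theorem exists_multiplication (Q : RSpace d → 𝕜) (hQ : Continuous Q) {C : ℝ} (hC : 0 ≤ C)
    (hb : ∀ x, ‖Q x‖ ≤ C) : ∃ B : LTwo 𝕜 d →L[𝕜] LTwo 𝕜 d, ‖B‖ ≤ C ∧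
      ∀ v : LTwo 𝕜 d, B v =ᵐ[volume] fun x => Q x * v x := by
  have hm : ∀ v : LTwo 𝕜 d, MemLp (fun x => Q x * v x) 2 volume := fun v =>
    (Lp.memLp v).of_le_mul (hQ.aestronglyMeasurable.mul (Lp.aestronglyMeasurable v))
      (ae_of_all _ fun x => by rw [norm_mul]; exact mul_le_mul_of_nonneg_right (hb x) (norm_nonneg _))
  let B : LTwo 𝕜 d →ₗ[𝕜] LTwo 𝕜 d :=
    { toFun := fun v => (hm v).toLp _
      map_add' := fun v v' => by
        refine Lp.ext ?_
        filter_upwards [(hm (v + v')).coeFn_toLp, Lp.coeFn_add ((hm v).toLp _) ((hm v').toLp _),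
          (hm v).coeFn_toLp, (hm v').coeFn_toLp, Lp.coeFn_add v v'] with x h1 h2 h3 h4 h5
        rw [h1, h2, Pi.add_apply, h3, h4, h5, Pi.add_apply, mul_add]
      map_smul' := fun c v => by
        refine Lp.ext ?_
        filter_upwards [(hm (c • v)).coeFn_toLp, Lp.coeFn_smul c ((hm v).toLp _),
          (hm v).coeFn_toLp, Lp.coeFn_smul c v] with x h1 h2 h3 h4
        rw [h1, RingHom.id_apply, h2, Pi.smul_apply, h3, h4, Pi.smul_apply, smul_eq_mul,
          smul_eq_mul, mul_left_comm] }
  refine ⟨B.mkContinuous C fun v => ?_, B.mkContinuous_norm_le hC _, fun v => (hm v).coeFn_toLp⟩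
  refine Lp.norm_le_mul_norm_of_ae_le_mul ?_
  filter_upwards [(hm v).coeFn_toLp] with x hx
  change ‖(hm v).toLp _ x‖ ≤ _
  rw [hx, norm_mul]
  exact mul_le_mul_of_nonneg_right (hb x) (norm_nonneg _)

end Multiplication

theorem exp_mul_log_inv_le {a ε : ℝ} {n : ℕ} (han : a ≤ n) (hε : ε ∈ Ioc (0 : ℝ) 1) :
    Real.exp (a * Real.log (1 / ε)) ≤ (ε ^ n)⁻¹ := by
  have h1 : 0 ≤ Real.log (1 / ε) := Real.log_nonneg (by rw [le_div_iff₀ hε.1]; simpa using hε.2)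
  calc _ ≤ Real.exp (n * Real.log (1 / ε)) := Real.exp_le_exp.2 (by gcongr)
    _ = _ := by
      rw [Real.exp_nat_mul, Real.exp_log (one_div_pos.2 hε.1), one_div, inv_pow]

theorem mainTheorem6 {𝕜 : Type*} [RCLike 𝕜] (d : ℕ) (T : ℝ) (hT : 0 < T)
    (L : LTwo 𝕜 d →ₗ.[𝕜] LTwo 𝕜 d) (hL : IsC0Generator L)
    (f : ℝ → LTwo 𝕜 d) (hf : ∃ K : NNReal, LipschitzOnWith K f (Set.Icc 0 T))
    (g : L.domain) (q : Distr 𝕜 d) :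
    ∃ (Q : ℝ → RSpace d → 𝕜) (u : ℝ → ℝ → L.domain),
      IsLogType Q ∧ IsVeryWeakSolution T L q f g Q u := by
  obtain ⟨Q, hQ, N, hN, hQN⟩ := exists_regularizingNet_logType q
  obtain ⟨K, hK⟩ := hf
  obtain ⟨M, C, hM, hC, hsol⟩ := hL.exists_solution hT.le hK g
  have hlog : ∀ ε ∈ Ioc (0 : ℝ) 1, 0 ≤ Real.log (1 / ε) := fun ε hε =>
    Real.log_nonneg (by rw [le_div_iff₀ hε.1]; simpa using hε.2)
  choose! B hBn hB using fun ε (hε : ε ∈ Ioc (0 : ℝ) 1) =>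
    exists_multiplication (Q ε) (hQ.smooth ε hε).continuous
      (mul_nonneg hN.le (by linarith [hlog ε hε])) (hQN ε hε)
  choose u huc hLuc hu0 hu using fun ε => hsol (B ε)
  refine ⟨Q, u, ⟨N, hN, hQN⟩, hQ, fun ε hε => ⟨huc ε, hLuc ε, fun t ht => ?_, hu0 ε⟩,
    fun ε _ => huc ε, ?_⟩
  · refine ⟨_, (hu ε t (Ioc_subset_Icc_self ht)).1, ?_⟩
    filter_upwards [Lp.coeFn_add (L (u ε t) - B ε (u ε t)) (f t),
      Lp.coeFn_sub (L (u ε t)) (B ε (u ε t)), hB ε hε (u ε t)] with x h1 h2 h3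
    rw [h1, Pi.add_apply, h2, Pi.sub_apply, h3]
    ring
  · obtain ⟨n, hn⟩ := exists_nat_ge (2 * M * N * T)
    refine ⟨n, (C + 1) * Real.exp ((2 * M * N + 1) * T), by positivity, fun ε hε t ht => ?_⟩
    have h1 : Real.exp ((2 * (M * ‖B ε‖) + 1) * T)
        ≤ Real.exp ((2 * M * N + 1) * T) * Real.exp (2 * M * N * T * Real.log (1 / ε)) := by
      rw [← Real.exp_add]
      refine Real.exp_le_exp.2 ?_
      calc _ ≤ (2 * (M * (N * (1 + Real.log (1 / ε)))) + 1) * T := by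
            gcongr
            exact hBn ε hε
        _ = _ := by ring
    calc _ ≤ C * Real.exp ((2 * (M * ‖B ε‖) + 1) * T) := (hu ε t ht).2
      _ ≤ (C + 1) * (Real.exp ((2 * M * N + 1) * T)
            * Real.exp (2 * M * N * T * Real.log (1 / ε))) :=
          mul_le_mul (by linarith) h1 (Real.exp_pos _).le (by linarith)
      _ ≤ (C + 1) * (Real.exp ((2 * M * N + 1) * T) * (ε ^ n)⁻¹) := by
          gcongr
          exact exp_mul_log_inv_le hn hε
      _ = _ := by ring
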